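/- Let $(I_n)_{n\ge 1}$ be intervals in $[0,1]$ with pairwise disjoint interiors and let $T:\operatorname{dom}(T)=\bigcup_{n\ge1} I_n\to[0,1]$ be a countable Markov interval map: (1) $(0,1)\subset T(I_n)$ for every $n$; (2) there is $\alpha>0$ such that $T$ is of class $C^{1+\alpha}$ (differentiable with locally $\alpha$-Hölder derivative) in the interior of each $I_n$; (3) $|T'(x)|>1$ for every $x$ in the interior of an $I_n$; (4) if $x\in\operatorname{dom}(T)\cap\{0,1\}$, then the one-sided derivative satisfies $|T'(x)|\ge1$. Let $\Lambda_T$ be the set of points all of whose iterates $T^n(x)$, $n\ge 0$, are defined and lie in $\operatorname{dom}(T)$, let $\mathcal B_T=\bigcup_{n\ge0}T^{-n}\bigl(\{0,1\}\cup\bigcup_m\partial I_m\bigr)$ be the set of boundary points, and put $X_T=\Lambda_T\setminus\mathcal B_T$, with the topology induced from $[0,1]$. Let $\mathbb N=\{1,2,\dots\}$ and let $\pi_T:\mathbb N^{\mathbb N}\to[0,1]$ be the coding map: $\pi_T(w)$ is the only point that lies, for all $n$, in the closure of $\{x: T^{k-1}(x)\in\operatorname{int} I_{w_k},\ 1\le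 k\le n\}$. Every $x\in X_T$ has exactly one code $\pi_T^{-1}(x)$. Let $O_1(w_1,w_2,w_3,\dots)=(\underbrace{1,\dots,1}_{w_1-1},w_2+1,w_3,\dots)$ and $O_T=\pi_T\circ O_1\circ\pi_T^{-1}$. Let $O$ be the dyadic odometer on $\{0,1\}^{\mathbb N}$ (addition of $(1,0,0,\dots)$ with carry to the right), and let $\kappa_T:X_T\to\{0,1\}^{\mathbb N}$ send a point with code $w$ to $1^{w_1-1}0\,1^{w_2-1}0\cdots$. Then $O_T$ maps $X_T$ into itself, and $O_T:X_T\to X_T$ has the following properties. 1. It is minimal (every forward orbit is dense in $X_T$) and uniquely ergodic (it has exactly one invariant Borel probability measure). 2. It has zero topological entropy: with respect to every totally bounded uniform structure that induces the topology of $X_T$, in particular the one given by the Euclidean distance, its Bowen (spanning set) entropy is $0$. 3. It has purely discrete spectrum (for its invariant probability measure $\mu$, the eigenfunctions of $g\mapsto g\circ O_T$ span a dense subspace of $L^2(\mu;\mathbb C)$), and it is equicontinuous: $\kappa_T$ is a homeomorphism onto its image, $\kappa_T\circ O_T=O\circ\kappa_T$, and the iterates $(O_T^n)_{n\ge0}$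 are uniformly equicontinuous for the uniform structure on $X_T$ (compatible with its topology) that $\kappa_T$ pulls back from the compact space $\{0,1\}^{\mathbb N}$. -/

import Mathlib

open Set Filter Topology MeasureTheory
open scoped NNReal

noncomputable section

/-- A countable Markov interval map `T` with branches `I 1, I 2, …`. The map is a partial function
with domain `⋃ n, I n`, represented by a function on `ℝ` whose values off the domain are never
used. Smoothness and expansion are required in the interiors of the branches only; at the points
`0` and `1`, when they belong to a branch, the derivative is the one-sided one. -/
structure IsCMI (I : ℕ+ → Set ℝ) (T : ℝ → ℝ) : Prop where
  interval : ∀ n, (I n).OrdConnected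
  subset_unit : ∀ n, I n ⊆ Icc 0 1
  disjoint_interior : Pairwise fun m n => Disjoint (interior (I m)) (interior (I n))
  mapsTo : ∀ n, MapsTo T (I n) (Icc 0 1)
  full : ∀ n, Ioo 0 1 ⊆ T '' I n
  differentiable : ∀ n, DifferentiableOn ℝ T (interior (I n))
  holder : ∃ α : ℝ≥0, 0 < α ∧ ∀ n, ∀ x ∈ interior (I n),
    ∃ C : ℝ≥0, ∃ U ∈ 𝓝 x, HolderOnWith C α (deriv T) U
  expanding : ∀ n, ∀ x ∈ interior (I n), 1 < |deriv T x|
  expanding_boundary : ∀ n, ∀ x ∈ I n, x = 0 ∨ x = 1 → 1 ≤ |derivWithin T (I n) x|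

namespace CMI

/-- The domain of `T`. -/
def dom (I : ℕ+ → Set ℝ) : Set ℝ := ⋃ n, I n

/-- The repeller: the points all of whose iterates are defined. -/
def repeller (I : ℕ+ → Set ℝ) (T : ℝ → ℝ) : Set ℝ := {x | ∀ n, T^[n] x ∈ dom I}

/-- The boundary points: those with some (defined) iterate in `{0, 1}` or at an endpoint of
a branch. -/
def boundary (I : ℕ+ → Set ℝ) (T : ℝ → ℝ) : Set ℝ :=
  {x | ∃ n, (∀ k < n, T^[k] x ∈ dom I) ∧ T^[n] x ∈ ({0, 1} : Set ℝ) ∪ ⋃ m, frontier (I m)}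

/-- The points of `dom T` at which all iterates of `T` are defined, minus the boundary points. -/
def phaseSpace (I : ℕ+ → Set ℝ) (T : ℝ → ℝ) : Set ℝ := repeller I T \ boundary I T

/-- The (open) cylinder of the word `w 0, …, w (n - 1)`. -/
def cylinder (I : ℕ+ → Set ℝ) (T : ℝ → ℝ) (w : ℕ → ℕ+) (n : ℕ) : Set ℝ :=
  {x | ∀ k < n, T^[k] x ∈ interior (I (w k))}

/-- The coding map: `w` is sent to the point that lies in the closures of all its cylinders. -/
def coding (I : ℕ+ → Set ℝ) (T : ℝ → ℝ) (w : ℕ → ℕ+) : ℝ :=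
  Classical.epsilon fun x => ∀ n, x ∈ closure (cylinder I T w n)

/-- The odometer on sequences of positive integers,
`(w₀, w₁, w₂, …) ↦ (1, …, 1, w₁ + 1, w₂, …)` with `w₀ - 1` leading ones. -/
def baireOdometer (w : ℕ → ℕ+) : ℕ → ℕ+ := fun i =>
  if i + 1 < (w 0 : ℕ) then 1 else if i + 1 = (w 0 : ℕ) then w 1 + 1 else w (i + 2 - (w 0 : ℕ))

/-- The odometer of `T`: the Baire odometer transported by the coding map. -/
def odometer (I : ℕ+ → Set ℝ) (T : ℝ → ℝ) (x : ℝ) : ℝ :=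
  coding I T (baireOdometer (Function.invFun (coding I T) x))

open scoped Classical in
/-- The dyadic odometer, addition of `(1, 0, 0, …)` with carry to the right: a digit is flipped
exactly when all the digits before it are `1`. -/
def dyadicOdometer (w : ℕ → Bool) : ℕ → Bool := fun i =>
  if ∀ j < i, w j = true then !(w i) else w i

open scoped Classical in
/-- The binary sequence `1^{w₀ - 1} 0 1^{w₁ - 1} 0 …`: its zeros stand where the block of some
`w j` ends. -/
def toDyadic (w : ℕ → ℕ+) : ℕ → Bool := fun i =>
  decide (¬ ∃ j, i + 1 = ∑ m ∈ Finset.range (j + 1), (w m : ℕ))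

/-- The conjugacy from the odometer of `T` to the dyadic odometer. -/
def dyadicCode (I : ℕ+ → Set ℝ) (T : ℝ → ℝ) (x : phaseSpace I T) : ℕ → Bool :=
  toDyadic (Function.invFun (coding I T) x)

end CMI

/-- Every forward orbit is dense. -/
def IsMinimalMap {X : Type*} [TopologicalSpace X] (f : X → X) : Prop :=
  ∀ x, Dense (range fun n : ℕ => f^[n] x)

/-- There is exactly one invariant Borel probability measure. -/
def IsUniquelyErgodic {X : Type*} [MeasurableSpace X] (f : X → X) : Prop :=
  ∃! μ : Measure X, IsProbabilityMeasure μ ∧ MeasurePreserving f μ μ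

/-- The topological entropy vanishes with respect to every totally bounded uniform structure that
induces the topology (for a bounded set of reals, the Euclidean one is such a structure; on a
compact space there is only one). -/
def HasZeroTopologicalEntropy {X : Type*} [t : TopologicalSpace X] (f : X → X) : Prop :=
  ∀ u : UniformSpace X, u.toTopologicalSpace = t → TotallyBounded (univ : Set X) →
    Dynamics.coverEntropy f univ = 0

/-- The eigenfunctions of the Koopman operator `g ↦ g ∘ f` span a dense subspace of `L²(μ)`. -/
def HasPurelyDiscreteSpectrum {X : Type*} [MeasurableSpace X] {f : X → X} {μ : Measure X}
    (hf : MeasurePreserving f μ μ) : Prop :=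
  (⨆ c : ℂ, Module.End.eigenspace
    (Lp.compMeasurePreservingₗᵢ (E := ℂ) (p := 2) ℂ f hf).toLinearMap c).topologicalClosure = ⊤

/-- The iterates of `f` are uniformly equicontinuous for the uniform structure that `κ` pulls back
to `X`. -/
def IsEquicontinuousVia {X Y : Type*} [v : UniformSpace Y] (κ : X → Y) (f : X → X) : Prop :=
  letI : UniformSpace X := UniformSpace.comap κ v
  UniformEquicontinuous fun n : ℕ => f^[n]

end

/-! The map `dyadicCode` turns the odometer of `T` into a restriction of the dyadic odometer, and
everything is read off from that. Adding one with carry acts as rotation by 1 on the residues modulo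
`2 ^ n` of binary sequences. Pulled back to the phase space, these residues form an `IsDyadicTower`:
factor maps onto the rotations of `ZMod (2 ^ n)` whose fibers are a basis of open sets.

Interval dynamics enters in two places. Cylinders are open and shrink uniformly
(`exists_forall_cylinder_abs_sub_lt`, by expansion on a compact part of the branches), so
`dyadicCode` is an embedding. Its range misses only countably many sequences: those with finitely
many zeros, and the images of codes with some shift that codes 0 or 1, where each endpoint has at
most one code.

The phase space need not be compact, so an invariant measure has to be produced: the Bernoulli
measure does not charge countable sets, hence restricts to the range. The rest is formal. Orbits
visit every fiber (minimality). An invariant probability measure gives each fiber mass `2 ^ (-n)`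
(unique ergodicity). Indicators of fibers are fixed by a power of the Koopman operator, hence are
sums of eigenvectors, and they are total in `L²`. Agreement of the first `n` digits is preserved by
the dynamics (equicontinuity).

Entropy is required for every totally bounded uniform structure, where long dyadic fibers need not
be uniformly small. But the proportion of fibers that are not small tends to 0, and an orbit segment
of length `2 ^ n` visits each fiber exactly once, so only a vanishing fraction of times contributes
to the count of dynamical balls. -/

namespace CMI

/-! ### Sequences of positive integers and binary sequences -/

/-- The sum of the first `j` terms. -/
def partialSum (w : ℕ → ℕ+) (j : ℕ) : ℕ := ∑ m ∈ Finset.range j, (w m : ℕ)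

@[simp] lemma partialSum_zero (w : ℕ → ℕ+) : partialSum w 0 = 0 := by simp [partialSum]

lemma partialSum_succ (w : ℕ → ℕ+) (j : ℕ) :
    partialSum w (j + 1) = partialSum w j + (w j : ℕ) := by
  simp [partialSum, Finset.sum_range_succ]

lemma partialSum_strictMono (w : ℕ → ℕ+) : StrictMono (partialSum w) :=
  strictMono_nat_of_lt_succ fun j => by
    rw [partialSum_succ]
    have := (w j).pos
    omega

lemma toDyadic_eq_false_iff (w : ℕ → ℕ+) (i : ℕ) :
    toDyadic w i = false ↔ ∃ j, i + 1 = partialSum w (j + 1) := by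
  simp [toDyadic, partialSum]

lemma toDyadic_eq_of_forall_eq {w v : ℕ → ℕ+} {i : ℕ} (h : ∀ k ≤ i, w k = v k) :
    toDyadic w i = toDyadic v i := by
  have key : ∀ {w v : ℕ → ℕ+}, (∀ k ≤ i, w k = v k) → toDyadic w i = false →
      toDyadic v i = false := by
    intro w v h hw
    rw [toDyadic_eq_false_iff] at hw ⊢
    obtain ⟨j, hj⟩ := hw
    -- Blocks have length at least 1, so a block ending at digit `i` involves only the entries up to
    -- `i`.
    have hji : j + 1 ≤ i + 1 := hj ▸ (partialSum_strictMono w).id_le (j + 1)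
    refine ⟨j, hj.trans (Finset.sum_congr rfl fun k hk => ?_)⟩
    rw [h k (by have := Finset.mem_range.1 hk; omega)]
  have h₁ := key h
  have h₂ := key fun k hk => (h k hk).symm
  revert h₁ h₂
  cases toDyadic w i <;> cases toDyadic v i <;> simp

/-- The binary digits up to the end of the `n`-th block determine the first `n` entries. -/
lemma forall_eq_of_toDyadic_eq {w v : ℕ → ℕ+} {n : ℕ}
    (h : ∀ i < partialSum w n, toDyadic w i = toDyadic v i) : ∀ k < n, w k = v k := by
  -- The next block ends at the first zero after the current one. Comparing in both directions shows
  -- that neither sequence can end its block earlier; the first comparison keeps the second within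
  -- the range of `h`.
  have key : ∀ k ≤ n, partialSum w k = partialSum v k := by
    intro k
    induction k with
    | zero => simp
    | succ k ih =>
      intro hk
      have ih := ih (by omega)
      have hw : toDyadic w (partialSum w (k + 1) - 1) = false :=
        (toDyadic_eq_false_iff _ _).2 ⟨k, by
          have := (partialSum_strictMono w).lt_iff_lt.2 (show k < k + 1 by omega); omega⟩
      have hpos := (partialSum_strictMono w).lt_iff_lt.2 (show k < k + 1 by omega)
      have hle : partialSum w (k + 1) ≤ partialSum w n := (partialSum_strictMono w).le_iff_le.2 hk
      rw [h _ (by omega), toDyadic_eq_false_iff] at hw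
      obtain ⟨l, hl⟩ := hw
      have hkl : k < l + 1 := (partialSum_strictMono v).lt_iff_lt.1 (by omega)
      have h₁ : partialSum v (k + 1) ≤ partialSum v (l + 1) :=
        (partialSum_strictMono v).le_iff_le.2 (by omega)
      have hposv := (partialSum_strictMono v).lt_iff_lt.2 (show k < k + 1 by omega)
      have hv : toDyadic v (partialSum v (k + 1) - 1) = false :=
        (toDyadic_eq_false_iff _ _).2 ⟨k, by omega⟩
      rw [← h _ (by omega), toDyadic_eq_false_iff] at hv
      obtain ⟨l', hl'⟩ := hv
      have hkl' : k < l' + 1 := (partialSum_strictMono w).lt_iff_lt.1 (by omega)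
      have h₂ : partialSum w (k + 1) ≤ partialSum w (l' + 1) :=
        (partialSum_strictMono w).le_iff_le.2 (by omega)
      omega
  intro k hk
  have h₁ := key k hk.le
  have h₂ := key (k + 1) hk
  rw [partialSum_succ, partialSum_succ] at h₂
  exact PNat.coe_injective (by omega)

/-- A binary sequence with infinitely many zeros is the image of a sequence of positive integers. -/
lemma exists_toDyadic_eq {y : ℕ → Bool} (hy : {i | y i = false}.Infinite) :
    ∃ w, toDyadic w = y := by
  set a : ℕ → ℕ := Nat.nth fun i => y i = false with ha
  have hmono : StrictMono a := Nat.nth_strictMono hy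
  have hpos : ∀ j, 0 < a (j + 1) - a j := fun j => Nat.sub_pos_of_lt (hmono (Nat.lt_succ_self j))
  let w : ℕ → ℕ+ := fun j => Nat.casesOn j ⟨a 0 + 1, Nat.succ_pos _⟩ fun j => ⟨_, hpos j⟩
  have hsum : ∀ j, partialSum w (j + 1) = a j + 1 := by
    intro j
    induction j with
    | zero =>
      rw [partialSum_succ, partialSum_zero, zero_add]
      rfl
    | succ j ih =>
      rw [partialSum_succ, ih]
      have := hpos j
      change a j + 1 + (a (j + 1) - a j) = _
      omega
  refine ⟨w, funext fun i => ?_⟩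
  have hiff : toDyadic w i = false ↔ y i = false := by
    rw [toDyadic_eq_false_iff]
    have hr : i ∈ range a ↔ y i = false := by
      rw [ha, Nat.range_nth_of_infinite hy]; rfl
    rw [← hr]
    simp only [hsum, mem_range]
    exact exists_congr fun j => by omega
  revert hiff
  cases toDyadic w i <;> cases y i <;> simp

lemma countable_setOf_finite_zeros : {y : ℕ → Bool | {i | y i = false}.Finite}.Countable := by
  have hinj : InjOn (fun y : ℕ → Bool => {i | y i = false}) univ := by
    intro y _ z _ h
    funext i
    have : y i = false ↔ z i = false := Set.ext_iff.1 h i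
    revert this
    cases y i <;> cases z i <;> simp
  refine Set.countable_of_injective_of_countable_image (hinj.mono (subset_univ _))
    ((Set.countable_ofPred_finite_subset (countable_univ (α := ℕ))).mono ?_)
  rintro _ ⟨y, hy, rfl⟩
  exact ⟨hy, subset_univ _⟩

lemma baireOdometer_of_le (w : ℕ → ℕ+) (k : ℕ) :
    baireOdometer w ((w 0 : ℕ) + k) = w (k + 2) := by
  have := (w 0).pos
  simp only [baireOdometer]
  rw [if_neg (by omega), if_neg (by omega)]
  congr 1
  omega

lemma partialSum_baireOdometer_of_lt (w : ℕ → ℕ+) {j : ℕ} (hj : j < (w 0 : ℕ)) :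
    partialSum (baireOdometer w) j = j := by
  rw [partialSum, Finset.sum_congr rfl (g := fun _ => 1), Finset.sum_const, Finset.card_range]
  · simp
  · intro k hk
    have := Finset.mem_range.1 hk
    simp [baireOdometer, show k + 1 < (w 0 : ℕ) by omega]

/-- The `w 0 - 1` ones and the entry `w 1 + 1` add up to `w 0 + w 1`, so from there on the block
ends of both sequences coincide. -/
lemma partialSum_baireOdometer_add (w : ℕ → ℕ+) (k : ℕ) :
    partialSum (baireOdometer w) ((w 0 : ℕ) + k) = partialSum w (k + 2) := by
  induction k with
  | zero =>
    obtain ⟨p, hp⟩ : ∃ p, (w 0 : ℕ) = p + 1 := ⟨(w 0 : ℕ) - 1, by have := (w 0).pos; omega⟩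
    rw [add_zero, hp, partialSum_succ, partialSum_baireOdometer_of_lt w (by omega)]
    have : baireOdometer w p = w 1 + 1 := by simp [baireOdometer, hp]
    rw [this, partialSum_succ, partialSum_succ]
    simp
    omega
  | succ k ih =>
    rw [← add_assoc, partialSum_succ, ih, baireOdometer_of_le, ← partialSum_succ]

/-- `toDyadic` conjugates the Baire odometer to the dyadic odometer. -/
lemma toDyadic_baireOdometer (w : ℕ → ℕ+) :
    toDyadic (baireOdometer w) = dyadicOdometer (toDyadic w) := by
  funext i
  have hw0 := (w 0).pos
  have hone : partialSum w 1 = (w 0 : ℕ) := by rw [partialSum_succ]; simp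
  have hfst : ∀ j, j + 1 < (w 0 : ℕ) → toDyadic w j = true := by
    intro j hj
    by_contra h
    obtain ⟨l, hl⟩ := (toDyadic_eq_false_iff w j).1 (by simpa using h)
    have := (partialSum_strictMono w).le_iff_le.2 (show 1 ≤ l + 1 by omega)
    omega
  have hfst' : toDyadic w ((w 0 : ℕ) - 1) = false :=
    (toDyadic_eq_false_iff _ _).2 ⟨0, by rw [zero_add, hone]; omega⟩
  -- The leading `1 … 1 0` of length `w 0` becomes `0 … 0 1`, and the later zeros stay in place:
  -- this is addition of one with carry.
  have hiff : toDyadic (baireOdometer w) i = false ↔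
      i + 1 < (w 0 : ℕ) ∨ ∃ k, i + 1 = partialSum w (k + 2) := by
    rw [toDyadic_eq_false_iff]
    constructor
    · rintro ⟨j, hj⟩
      rcases lt_or_ge (j + 1) (w 0 : ℕ) with h | h
      · rw [partialSum_baireOdometer_of_lt w h] at hj
        exact Or.inl (hj ▸ h)
      · obtain ⟨k, hk⟩ := Nat.exists_eq_add_of_le h
        rw [hk, partialSum_baireOdometer_add] at hj
        exact Or.inr ⟨k, hj⟩
    · rintro (h | ⟨k, hk⟩)
      · exact ⟨i, (partialSum_baireOdometer_of_lt w h).symm⟩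
      · refine ⟨(w 0 : ℕ) + k - 1, ?_⟩
        rw [show (w 0 : ℕ) + k - 1 + 1 = (w 0 : ℕ) + k by omega, partialSum_baireOdometer_add, hk]
  have htwo : ∀ k, (w 0 : ℕ) < partialSum w (k + 2) := fun k =>
    hone ▸ (partialSum_strictMono w).lt_iff_lt.2 (by omega)
  rw [dyadicOdometer]
  rcases lt_trichotomy (i + 1) (w 0 : ℕ) with h | h | h
  · rw [if_pos fun j hj => hfst j (by omega), hfst i h, hiff.2 (Or.inl h)]; rfl
  · rw [if_pos fun j hj => hfst j (by omega), show i = (w 0 : ℕ) - 1 by omega, hfst',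
      show (w 0 : ℕ) - 1 = i by omega]
    by_contra hne
    rcases hiff.1 (by simpa using hne) with h' | ⟨k, hk⟩
    · omega
    · have := htwo k; omega
  · rw [if_neg fun hall => by
      have := hall ((w 0 : ℕ) - 1) (by omega)
      rw [hfst'] at this
      exact absurd this (by simp)]
    have hiff' : toDyadic (baireOdometer w) i = false ↔ toDyadic w i = false := by
      rw [hiff, toDyadic_eq_false_iff]
      constructor
      · rintro (h' | ⟨k, hk⟩)
        · omega
        · exact ⟨k + 1, hk⟩
      · rintro ⟨j, hj⟩
        cases j with
        | zero => rw [zero_add, hone] at hj; omega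
        | succ k => exact Or.inr ⟨k, hj⟩
    revert hiff'
    cases toDyadic (baireOdometer w) i <;> cases toDyadic w i <;> simp

/-! ### Residues of binary sequences modulo powers of two -/

/-- The number with the first `n` binary digits of `y`. -/
def digitSum (n : ℕ) (y : ℕ → Bool) : ℕ := ∑ i ∈ Finset.range n, (y i).toNat * 2 ^ i

lemma digitSum_succ (n : ℕ) (y : ℕ → Bool) :
    digitSum (n + 1) y = digitSum n y + (y n).toNat * 2 ^ n := by
  simp [digitSum, Finset.sum_range_succ]

lemma digitSum_lt (n : ℕ) (y : ℕ → Bool) : digitSum n y < 2 ^ n := by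
  induction n with
  | zero => simp [digitSum]
  | succ n ih =>
    rw [digitSum_succ, pow_succ]
    cases y n <;> simp <;> omega

lemma digitSum_eq_iff (n : ℕ) (y z : ℕ → Bool) :
    digitSum n y = digitSum n z ↔ ∀ i < n, y i = z i := by
  refine ⟨fun h => ?_, fun h => Finset.sum_congr rfl fun i hi => by
    rw [h i (Finset.mem_range.1 hi)]⟩
  induction n with
  | zero => simp
  | succ n ih =>
    have h₁ := digitSum_lt n y
    have h₂ := digitSum_lt n z
    rw [digitSum_succ, digitSum_succ] at h
    have hn : y n = z n ∧ digitSum n y = digitSum n z := by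
      revert h
      cases y n <;> cases z n <;> simp <;> omega
    intro i hi
    rcases Nat.lt_succ_iff_lt_or_eq.1 hi with hi | rfl
    · exact ih hn.2 i hi
    · exact hn.1

-- The conditional term is the carry out of the first `n` digits, which disappears modulo `2 ^ n`.
open scoped Classical in
lemma digitSum_dyadicOdometer (n : ℕ) (y : ℕ → Bool) :
    digitSum n (dyadicOdometer y) + (if ∀ j < n, y j = true then 2 ^ n else 0) =
      digitSum n y + 1 := by
  induction n with
  | zero => simp [digitSum]
  | succ n ih =>
    rw [digitSum_succ, digitSum_succ]
    have hall : (∀ j < n + 1, y j = true) ↔ (∀ j < n, y j = true) ∧ y n = true :=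
      Nat.forall_lt_succ_right
    by_cases h : ∀ j < n, y j = true
    · rw [if_pos h] at ih
      have hflip : dyadicOdometer y n = !(y n) := by simp only [dyadicOdometer, if_pos h]
      rw [hflip]
      cases hn : y n
      · rw [if_neg fun h' => by simpa [hn] using (hall.1 h').2]
        simp only [Bool.not_false, Bool.toNat_true, Bool.toNat_false]
        omega
      · rw [if_pos (hall.2 ⟨h, hn⟩), pow_succ]
        simp only [Bool.not_true, Bool.toNat_true, Bool.toNat_false]
        omega
    · rw [if_neg h] at ih
      rw [if_neg (fun h' => h (hall.1 h').1)]
      have : dyadicOdometer y n = y n := by simp only [dyadicOdometer, if_neg h]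
      rw [this]
      omega

/-- The residue modulo `2 ^ n` of a binary sequence. -/
def residue (n : ℕ) (y : ℕ → Bool) : ZMod (2 ^ n) := (digitSum n y : ZMod (2 ^ n))

lemma residue_eq_iff (n : ℕ) (y z : ℕ → Bool) :
    residue n y = residue n z ↔ ∀ i < n, y i = z i := by
  rw [← digitSum_eq_iff, residue, residue, ZMod.natCast_eq_natCast_iff]
  exact ⟨fun h => Nat.ModEq.eq_of_lt_of_lt h (digitSum_lt n y) (digitSum_lt n z),
    fun h => h ▸ Nat.ModEq.refl _⟩

lemma residue_dyadicOdometer (n : ℕ) (y : ℕ → Bool) :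
    residue n (dyadicOdometer y) = residue n y + 1 := by
  classical
  have h := congrArg (Nat.cast (R := ZMod (2 ^ n))) (digitSum_dyadicOdometer n y)
  have hz : ((2 ^ n : ℕ) : ZMod (2 ^ n)) = 0 := ZMod.natCast_self _
  rw [Nat.cast_add, Nat.cast_add, Nat.cast_one] at h
  split_ifs at h
  · rwa [hz, add_zero] at h
  · rwa [Nat.cast_zero, add_zero] at h

end CMI

/-! ### Systems that factor compatibly onto the rotations of `ZMod (2 ^ n)` -/

/-- A vector fixed by a power of a complex linear map is a sum of eigenvectors. -/
lemma mem_iSup_eigenspace_of_pow_apply_eq {V : Type*} [AddCommGroup V] [Module ℂ V]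
    (U : Module.End ℂ V) {N : ℕ} (hN : N ≠ 0) {v : V} (hv : (U ^ N) v = v) :
    v ∈ ⨆ c : ℂ, Module.End.eigenspace U c := by
  have hζ := Complex.isPrimitiveRoot_exp N hN
  set ζ := Complex.exp (2 * Real.pi * Complex.I / N)
  have hζ0 : ζ ≠ 0 := hζ.ne_zero hN
  -- Discrete Fourier components of the orbit of `v`, up to the factor `N`: `e j` has eigenvalue `ζ
  -- ^ (-j)`, and the `e j` sum to `N • v`.
  let e : ℕ → V := fun j => ∑ k ∈ Finset.range N, ζ ^ (j * k) • (U ^ k) v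
  have he : ∀ j, e j ∈ ⨆ c : ℂ, Module.End.eigenspace U c := by
    intro j
    refine Submodule.mem_iSup_of_mem ((ζ ^ j)⁻¹) (Module.End.mem_eigenspace_iff.2 ?_)
    have hshift : ζ ^ j • U (e j) = e j := by
      have h₁ : ζ ^ j • U (e j) =
          ∑ k ∈ Finset.range N, ζ ^ (j * (k + 1)) • (U ^ (k + 1)) v := by
        simp only [e, map_sum, Finset.smul_sum, map_smul, smul_smul]
        refine Finset.sum_congr rfl fun k _ => ?_
        rw [pow_succ' U, Module.End.mul_apply, ← pow_add]
        congr 2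
        ring
      have h₂ := Finset.sum_range_succ (fun k => ζ ^ (j * k) • (U ^ k) v) N
      rw [Finset.sum_range_succ'] at h₂
      have h₃ : ζ ^ (j * N) • (U ^ N) v = ζ ^ (j * 0) • (U ^ 0) v := by
        rw [mul_comm, pow_mul, hζ.pow_eq_one, hv]
        simp
      rw [h₃] at h₂
      rw [h₁]
      exact add_right_cancel h₂
    rw [eq_inv_smul_iff₀ (pow_ne_zero _ hζ0), hshift]
  have hsum : ∑ j ∈ Finset.range N, e j = (N : ℂ) • v := by
    simp only [e]
    rw [Finset.sum_comm]
    simp only [← Finset.sum_smul]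
    rw [Finset.sum_eq_single_of_mem 0 (Finset.mem_range.2 (Nat.pos_of_ne_zero hN))]
    · simp
    · intro k hk hk0
      have hne : ζ ^ k ≠ 1 := hζ.pow_ne_one_of_pos_of_lt hk0 (Finset.mem_range.1 hk)
      have h0 : ∑ j ∈ Finset.range N, ζ ^ (j * k) = 0 := by
        have := mul_neg_geom_sum (ζ ^ k) N
        rw [← pow_mul, mul_comm k N, pow_mul, hζ.pow_eq_one, one_pow, sub_self] at this
        rw [← (mul_eq_zero.1 this).resolve_left (sub_ne_zero_of_ne hne.symm)]
        exact Finset.sum_congr rfl fun j _ => by rw [← pow_mul, mul_comm]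
      rw [h0, zero_smul]
  have hN' : (N : ℂ) ≠ 0 := Nat.cast_ne_zero.2 hN
  rw [← inv_smul_smul₀ hN' v, ← hsum]
  exact Submodule.smul_mem _ _ (Submodule.sum_mem _ fun j _ => he j)

/-- The maps `r n` form a compatible sequence of factor maps of `f` onto the rotations by `1` of
`ZMod (2 ^ n)`, and their fibers are a basis of the topology. -/
structure IsDyadicTower {X : Type*} [TopologicalSpace X] (f : X → X)
    (r : ∀ n : ℕ, X → ZMod (2 ^ n)) : Prop where
  map_apply : ∀ n x, r n (f x) = r n x + 1
  isOpen_fiber : ∀ n c, IsOpen (r n ⁻¹' {c})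
  exists_fiber_subset : ∀ x, ∀ V ∈ 𝓝 x, ∃ n, r n ⁻¹' {r n x} ⊆ V
  eq_of_le : ∀ {m n x y}, m ≤ n → r n x = r n y → r m x = r m y

namespace IsDyadicTower

variable {X : Type*} [TopologicalSpace X] {f : X → X} {r : ∀ n : ℕ, X → ZMod (2 ^ n)}

lemma iterate_apply (h : IsDyadicTower f r) (n k : ℕ) (x : X) : r n (f^[k] x) = r n x + k := by
  induction k with
  | zero => simp
  | succ k ih => rw [Function.iterate_succ_apply', h.map_apply, ih, Nat.cast_succ, add_assoc]

lemma isMinimalMap (h : IsDyadicTower f r) : IsMinimalMap f := by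
  intro x y
  rw [mem_closure_iff_nhds]
  intro V hV
  obtain ⟨n, hn⟩ := h.exists_fiber_subset y V hV
  refine ⟨f^[(r n y - r n x).val] x, hn ?_, mem_range_self _⟩
  change r n _ = r n y
  rw [h.iterate_apply, ZMod.natCast_zmod_val]
  ring

lemma continuous (h : IsDyadicTower f r) : Continuous f := by
  rw [continuous_iff_continuousAt]
  intro x V hV
  obtain ⟨n, hn⟩ := h.exists_fiber_subset (f x) V hV
  refine mem_map.2 (mem_of_superset ((h.isOpen_fiber n (r n x)).mem_nhds rfl) fun y hy => hn ?_)
  have hy : r n y = r n x := hy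
  change r n (f y) = r n (f x)
  rw [h.map_apply, h.map_apply, hy]

/-- The fibers of the maps `r n`. -/
def fibers (r : ∀ n : ℕ, X → ZMod (2 ^ n)) : Set (Set X) :=
  range fun p : Σ n : ℕ, ZMod (2 ^ n) => r p.1 ⁻¹' {p.2}

lemma isTopologicalBasis_fibers (h : IsDyadicTower f r) :
    TopologicalSpace.IsTopologicalBasis (fibers r) := by
  refine TopologicalSpace.isTopologicalBasis_of_isOpen_of_nhds ?_ ?_
  · rintro _ ⟨p, rfl⟩
    exact h.isOpen_fiber _ _
  · intro x V hx hV
    obtain ⟨n, hn⟩ := h.exists_fiber_subset x V (hV.mem_nhds hx)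
    exact ⟨_, ⟨⟨n, r n x⟩, rfl⟩, rfl, hn⟩

/-- By compatibility of the levels, two fibers are either nested or disjoint. -/
lemma isPiSystem_fibers (h : IsDyadicTower f r) : IsPiSystem (fibers r) := by
  have key : ∀ m n, m ≤ n → ∀ c d x, r m x = c → r n x = d →
      r m ⁻¹' {c} ∩ r n ⁻¹' {d} = r n ⁻¹' {d} := by
    rintro m n hmn c d x rfl rfl
    exact inter_eq_right.2 fun y hy => h.eq_of_le hmn hy
  rintro _ ⟨⟨m, c⟩, rfl⟩ _ ⟨⟨n, d⟩, rfl⟩ ⟨x, hx, hx'⟩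
  rcases le_total m n with hmn | hmn
  · rw [key m n hmn c d x hx hx']
    exact ⟨⟨n, d⟩, rfl⟩
  · rw [inter_comm, key n m hmn d c x hx' hx]
    exact ⟨⟨m, c⟩, rfl⟩

/-! ### Invariant measures and spectrum of a dyadic tower -/

variable [MeasurableSpace X] [BorelSpace X]

lemma generateFrom_fibers (h : IsDyadicTower f r) :
    ‹MeasurableSpace X› = MeasurableSpace.generateFrom (fibers r) := by
  have hc : (fibers r).Countable := countable_range _
  have := h.isTopologicalBasis_fibers.secondCountableTopology hc
  rw [BorelSpace.measurable_eq (α := X), h.isTopologicalBasis_fibers.borel_eq_generateFrom]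

lemma measurableSet_fiber (h : IsDyadicTower f r) (n : ℕ) (c : ZMod (2 ^ n)) :
    MeasurableSet (r n ⁻¹' {c}) := (h.isOpen_fiber n c).measurableSet

lemma measure_preimage_eq_sum (h : IsDyadicTower f r) (μ : Measure X) (n : ℕ)
    (s : Finset (ZMod (2 ^ n))) : μ (r n ⁻¹' s) = ∑ c ∈ s, μ (r n ⁻¹' {c}) := by
  rw [← Set.biUnion_preimage_singleton, ← measure_biUnion_finset]
  · rfl
  · intro c _ d _ hcd
    exact Disjoint.preimage _ (disjoint_singleton.2 hcd)
  · exact fun c _ => h.measurableSet_fiber n c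

lemma measure_fiber_of_forall_eq (h : IsDyadicTower f r) {μ : Measure X} [IsProbabilityMeasure μ]
    {n : ℕ} (hμ : ∀ c, μ (r n ⁻¹' {c}) = μ (r n ⁻¹' {0})) (c : ZMod (2 ^ n)) :
    μ (r n ⁻¹' {c}) = (2 ^ n)⁻¹ := by
  have hsum := h.measure_preimage_eq_sum μ n Finset.univ
  rw [Finset.sum_congr rfl fun c _ => hμ c, Finset.coe_univ, preimage_univ, measure_univ,
    Finset.sum_const, Finset.card_univ, ZMod.card, nsmul_eq_mul] at hsum
  rw [hμ]
  refine ENNReal.eq_inv_of_mul_eq_one_left ?_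
  rw [hsum, mul_comm]
  norm_cast

/-- An invariant probability measure gives the same mass to all fibers of `r n`. -/
lemma measure_fiber (h : IsDyadicTower f r) {μ : Measure X} [IsProbabilityMeasure μ]
    (hμ : MeasurePreserving f μ μ) (n : ℕ) (c : ZMod (2 ^ n)) :
    μ (r n ⁻¹' {c}) = (2 ^ n)⁻¹ := by
  refine h.measure_fiber_of_forall_eq (fun c => ?_) c
  have hpre : r n ⁻¹' {0} = f^[c.val] ⁻¹' (r n ⁻¹' {c}) := by
    ext x
    simp only [mem_preimage, mem_singleton_iff]
    rw [h.iterate_apply, ZMod.natCast_zmod_val]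
    simp
  rw [hpre, (hμ.iterate _).measure_preimage (h.measurableSet_fiber n c).nullMeasurableSet]

lemma measure_ext (h : IsDyadicTower f r) {μ ν : Measure X} [IsProbabilityMeasure μ]
    [IsProbabilityMeasure ν] (hμν : ∀ n c, μ (r n ⁻¹' {c}) = ν (r n ⁻¹' {c})) : μ = ν := by
  refine ext_of_generate_finite _ h.generateFrom_fibers h.isPiSystem_fibers ?_ (by simp)
  rintro _ ⟨⟨n, c⟩, rfl⟩
  exact hμν n c

lemma measurePreserving_of_forall (h : IsDyadicTower f r) {μ : Measure X} [IsProbabilityMeasure μ]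
    (hμ : ∀ n c, μ (r n ⁻¹' {c}) = (2 ^ n)⁻¹) : MeasurePreserving f μ μ := by
  have hf := h.continuous.measurable
  refine ⟨hf, ?_⟩
  have : IsProbabilityMeasure (μ.map f) := Measure.isProbabilityMeasure_map hf.aemeasurable
  refine h.measure_ext fun n c => ?_
  rw [Measure.map_apply hf (h.measurableSet_fiber n c), hμ n c, ← hμ n (c - 1)]
  congr 1
  ext x
  simp only [mem_preimage, mem_singleton_iff, h.map_apply, eq_sub_iff_add_eq]

lemma isUniquelyErgodic (h : IsDyadicTower f r) {μ : Measure X} [IsProbabilityMeasure μ]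
    (hμ : MeasurePreserving f μ μ) : IsUniquelyErgodic f := by
  refine ⟨μ, ⟨inferInstance, hμ⟩, ?_⟩
  rintro ν ⟨hν, hν'⟩
  exact h.measure_ext fun n c => by rw [h.measure_fiber hμ, h.measure_fiber hν']

lemma hasPurelyDiscreteSpectrum (h : IsDyadicTower f r) {μ : Measure X} [IsProbabilityMeasure μ]
    (hμ : MeasurePreserving f μ μ) : HasPurelyDiscreteSpectrum hμ := by
  rw [HasPurelyDiscreteSpectrum, Submodule.topologicalClosure_eq_top_iff, Submodule.eq_bot_iff]
  intro g hg
  -- It suffices that a vector `g` orthogonal to all eigenspaces vanishes. It is orthogonal to the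
  -- indicators of fibers, so its integrals vanish on a generating π-system.
  have hgi : Integrable g μ := (Lp.memLp g).integrable one_le_two
  have hfib : ∀ n c, ∫ x in r n ⁻¹' {c}, g x ∂μ = 0 := by
    intro n c
    have hm := h.measurableSet_fiber n c
    rw [← L2.inner_indicatorConstLp_one hm (measure_ne_top μ _) g]
    refine (Submodule.mem_orthogonal _ _).1 hg _
      (mem_iSup_eigenspace_of_pow_apply_eq _ (pow_ne_zero n two_ne_zero) ?_)
    rw [Module.End.pow_apply]
    change (Lp.compMeasurePreserving f hμ)^[2 ^ n] _ = _
    rw [Lp.compMeasurePreserving_iterate, Lp.indicatorConstLp_compMeasurePreserving]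
    congr 1
    ext x
    simp only [mem_preimage, mem_singleton_iff]
    rw [h.iterate_apply, ZMod.natCast_self, add_zero]
  have hall : ∀ s, MeasurableSet s → ∫ x in s, g x ∂μ = 0 := by
    -- The whole space is the fiber at level 0, since `ZMod 1` is trivial.
    have huniv : ∫ x, g x ∂μ = 0 := by
      rw [← setIntegral_univ, ← hfib 0 0]
      congr 2
      ext x
      simpa using Subsingleton.elim (α := ZMod 1) _ _
    intro s hs
    induction s, hs using MeasurableSpace.induction_on_inter h.generateFrom_fibers
      h.isPiSystem_fibers with
    | empty => simp
    | basic t ht =>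
      obtain ⟨⟨n, c⟩, rfl⟩ := ht
      exact hfib n c
    | compl t htm ih =>
      have := integral_add_compl htm hgi
      rwa [ih, huniv, zero_add] at this
    | iUnion s hd hm ih =>
      rw [integral_iUnion hm hd hgi.integrableOn]
      simp [ih]
  exact (Lp.eq_zero_iff_ae_eq_zero).2
    (hgi.ae_eq_zero_of_forall_setIntegral_eq_zero fun s hs _ => hall s hs)

end IsDyadicTower

/-! ### Zero entropy of a dyadic tower -/

namespace IsDyadicTower

variable {X : Type*} [TopologicalSpace X] {f : X → X} {r : ∀ n : ℕ, X → ZMod (2 ^ n)}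

/-- The residues whose fiber is not `V`-small. -/
def badResidues (r : ∀ n : ℕ, X → ZMod (2 ^ n)) (V : SetRel X X) (n : ℕ) :
    Set (ZMod (2 ^ n)) :=
  {c | ∃ x y, r n x = c ∧ r n y = c ∧ (x, y) ∉ V}

/-- The proportion of residues whose fiber is not `V`-small tends to zero. -/
lemma tendsto_ncard_badResidues [MeasurableSpace X] [BorelSpace X] (h : IsDyadicTower f r)
    {μ : Measure X} [IsProbabilityMeasure μ] (hμ : MeasurePreserving f μ μ) {V : SetRel X X}
    (hV : ∀ x, ∃ W ∈ 𝓝 x, ∀ y ∈ W, ∀ z ∈ W, (y, z) ∈ V) :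
    Tendsto (fun n => ((badResidues r V n).ncard : ℝ) / 2 ^ n) atTop (𝓝 0) := by
  classical
  -- The unions of bad fibers decrease with `n`, and every point leaves them once its fiber lies in
  -- a small neighborhood. Continuity of `μ` from above gives mass tending to 0, and this mass is
  -- the proportion of bad residues.
  have hanti : Antitone fun n => r n ⁻¹' badResidues r V n := by
    intro m n hmn x hx
    obtain ⟨y, z, hy, hz, hyz⟩ := hx
    exact ⟨y, z, h.eq_of_le hmn hy, h.eq_of_le hmn hz, hyz⟩
  have hempty : ⋂ n, r n ⁻¹' badResidues r V n = ∅ := by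
    refine eq_empty_of_forall_notMem fun x hx => ?_
    obtain ⟨W, hW, hWV⟩ := hV x
    obtain ⟨n, hn⟩ := h.exists_fiber_subset x W hW
    obtain ⟨y, z, hy, hz, hyz⟩ := mem_iInter.1 hx n
    exact hyz (hWV y (hn hy) z (hn hz))
  have hcoe : ∀ n, ((badResidues r V n).toFinset : Set (ZMod (2 ^ n))) = badResidues r V n :=
    fun n => coe_toFinset _
  have hmeas : ∀ n, MeasurableSet (r n ⁻¹' badResidues r V n) := by
    intro n
    rw [← Set.biUnion_preimage_singleton]
    exact MeasurableSet.biUnion (to_countable _) fun c _ => h.measurableSet_fiber n c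
  have hlim := tendsto_measure_iInter_atTop (μ := μ) (fun n => (hmeas n).nullMeasurableSet) hanti
    ⟨0, measure_ne_top _ _⟩
  rw [hempty, measure_empty] at hlim
  have hlim' := (ENNReal.tendsto_toReal ENNReal.zero_ne_top).comp hlim
  refine hlim'.congr fun n => ?_
  simp only [Function.comp_apply]
  rw [← hcoe n, h.measure_preimage_eq_sum μ n,
    Finset.sum_congr rfl fun c _ => h.measure_fiber hμ n c, Finset.sum_const, ncard_coe_finset]
  simp [div_eq_mul_inv]

/-- A cover of the space by dynamical balls, counted by the residue of the center and its position
at the times at which its fiber is not small. -/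
lemma exists_isDynCoverOf (h : IsDyadicTower f r) {V W : SetRel X X} [W.IsSymm]
    (hWV : SetRel.comp W W ⊆ V) {t : Set X} (ht : t.Finite)
    (hcov : (univ : Set X) ⊆ ⋃ y ∈ t, {x | (x, y) ∈ W}) (n : ℕ) :
    ∃ s : Finset X, Dynamics.IsDynCoverOf f univ V (2 ^ n) s ∧
      s.card ≤ 2 ^ n * t.ncard ^ (badResidues r V n).ncard := by
  classical
  have := ht.fintype
  have hp : ∀ x, ∃ y : t, (x, (y : X)) ∈ W := by
    intro x
    obtain ⟨y, hy, hxy⟩ := mem_iUnion₂.1 (hcov (mem_univ x))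
    exact ⟨⟨y, hy⟩, hxy⟩
  choose p hp using hp
  -- Within `2 ^ n` steps the orbit of `x` is in the fiber over `c` exactly once, at time `(c - r n
  -- x).val`. `Φ` records the starting residue and, at each bad time, a point of `t` close to the
  -- orbit. At good times equal residues already force closeness.
  let Φ : X → ZMod (2 ^ n) × (badResidues r V n → t) := fun x =>
    (r n x, fun c => p (f^[((c : ZMod (2 ^ n)) - r n x).val] x))
  have hfin : (range Φ).Finite := toFinite _
  let g : range Φ → X := fun a => a.2.choose
  have hg : ∀ a, Φ (g a) = a := fun a => a.2.choose_spec
  refine ⟨Finset.univ.image g, ?_, ?_⟩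
  · intro x _
    refine ⟨g ⟨Φ x, mem_range_self x⟩, by simp, ?_⟩
    have hΦ := hg ⟨Φ x, mem_range_self x⟩
    set y := g ⟨Φ x, mem_range_self x⟩
    have hr : r n y = r n x := congrArg Prod.fst hΦ
    refine Dynamics.mem_dynEntourage.2 fun k hk => ?_
    by_cases hb : r n x + k ∈ badResidues r V n
    · have hpk := congrFun (congrArg Prod.snd hΦ) ⟨_, hb⟩
      simp only [Φ, hr, add_sub_cancel_left, ZMod.val_natCast, Nat.mod_eq_of_lt hk] at hpk
      refine hWV ⟨p (f^[k] x), hp _, W.symm ?_⟩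
      rw [← hpk]
      exact hp _
    · by_contra hxy
      exact hb ⟨_, _, h.iterate_apply n k x, by rw [h.iterate_apply n k y, hr], hxy⟩
  · refine Finset.card_image_le.trans ?_
    rw [Finset.card_univ, ← Nat.card_eq_fintype_card]
    refine (Nat.card_le_card_of_injective _ Subtype.val_injective).trans ?_
    rw [Nat.card_prod, Nat.card_fun, Nat.card_zmod]
    rfl

lemma hasZeroTopologicalEntropy [MeasurableSpace X] [BorelSpace X] (h : IsDyadicTower f r)
    {μ : Measure X} [IsProbabilityMeasure μ] (hμ : MeasurePreserving f μ μ) :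
    HasZeroTopologicalEntropy f := by
  intro u hu htb
  subst hu
  have hne : (univ : Set X).Nonempty := by
    have : Nonempty X := nonempty_of_isProbabilityMeasure μ
    exact univ_nonempty
  refine le_antisymm (iSup₂_le fun U hU => ?_) (Dynamics.coverEntropy_nonneg f hne)
  -- Two halvings of `U`: a dynamical cover at scale `V` bounds the entropy only at scale `V ∘ V`,
  -- and building that cover takes two steps of size `W`.
  obtain ⟨V, hV, hVs, hVU⟩ := comp_symm_mem_uniformity_sets hU
  obtain ⟨W, hW, hWs, hWV⟩ := comp_symm_mem_uniformity_sets hV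
  obtain ⟨t, ht, hcov⟩ := htb W hW
  have hsmall : ∀ x, ∃ N ∈ 𝓝 x, ∀ y ∈ N, ∀ z ∈ N, (y, z) ∈ V := fun x =>
    ⟨UniformSpace.ball x W, UniformSpace.ball_mem_nhds x hW, fun y hy z hz =>
      hWV ⟨x, SetRel.symm W hy, hz⟩⟩
  have hlim := h.tendsto_ncard_badResidues hμ hsmall
  set b : ℕ → ℕ := fun n => (badResidues r V n).ncard
  have hbound : ∀ n : ℕ, Dynamics.coverEntropyEntourage f univ U ≤
      (((n : ℝ) / 2 ^ n * Real.log 2 + (b n : ℝ) / 2 ^ n * Real.log t.ncard : ℝ) : EReal) := by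
    intro n
    obtain ⟨s, hs, hcard⟩ := h.exists_isDynCoverOf hWV ht hcov n
    refine (Dynamics.coverEntropyEntourage_antitone f univ hVU).trans
      ((hs.coverEntropyEntourage_le_log_card_div (mapsTo_univ _ _) (by positivity)).trans ?_)
    have hspos : 0 < s.card := Finset.card_pos.2 (by simpa using hs.nonempty hne)
    have htpos : 0 < t.ncard := by
      rw [ncard_pos ht]
      obtain ⟨x⟩ := hne
      obtain ⟨y, hy, -⟩ := mem_iUnion₂.1 (hcov (mem_univ x))
      exact ⟨y, hy⟩
    have hlog : ENNReal.log (s.card : ENNReal) = ((Real.log s.card : ℝ) : EReal) := by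
      rw [← ENNReal.ofReal_natCast, ENNReal.log_ofReal_of_pos (by exact_mod_cast hspos)]
    rw [hlog, show (((2 ^ n : ℕ) : ℕ) : EReal) = ((2 ^ n : ℝ) : EReal) by norm_cast,
      ← EReal.coe_div, EReal.coe_le_coe_iff]
    have hle : Real.log s.card ≤ n * Real.log 2 + b n * Real.log t.ncard := by
      have : (s.card : ℝ) ≤ 2 ^ n * (t.ncard : ℝ) ^ b n := by exact_mod_cast hcard
      refine (Real.log_le_log (by exact_mod_cast hspos) this).trans_eq ?_
      rw [Real.log_mul (by positivity) (by positivity), Real.log_pow, Real.log_pow]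
    rw [div_le_iff₀ (by positivity)]
    refine hle.trans_eq ?_
    field_simp
  have hn : Tendsto (fun n : ℕ => (n : ℝ) / 2 ^ n) atTop (𝓝 0) := by
    simpa using tendsto_pow_const_div_const_pow_of_one_lt 1 (one_lt_two (α := ℝ))
  have htot := (hn.mul_const (Real.log 2)).add (hlim.mul_const (Real.log t.ncard))
  rw [zero_mul, zero_mul, add_zero] at htot
  exact ge_of_tendsto' (continuous_coe_real_ereal.tendsto _ |>.comp htot) hbound

end IsDyadicTower

namespace CMI

/-! ### The Bernoulli measure and embedded odometers -/

lemma isOpen_setOf_forall_lt_eq (y : ℕ → Bool) (n : ℕ) :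
    IsOpen {z : ℕ → Bool | ∀ i < n, z i = y i} := by
  have : {z : ℕ → Bool | ∀ i < n, z i = y i} = ⋂ i ∈ Finset.range n, (· i) ⁻¹' {y i} := by
    ext z
    simp
  rw [this]
  exact isOpen_biInter_finset fun i _ => (isOpen_discrete _).preimage (continuous_apply i)

lemma exists_setOf_forall_lt_eq_subset {y : ℕ → Bool} {V : Set (ℕ → Bool)} (hV : V ∈ 𝓝 y) :
    ∃ n, {z : ℕ → Bool | ∀ i < n, z i = y i} ⊆ V := by
  rw [nhds_pi, Filter.mem_pi] at hV
  obtain ⟨J, hJ, t, ht, hsub⟩ := hV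
  obtain ⟨n, hn⟩ := hJ.bddAbove
  refine ⟨n + 1, fun z hz => hsub fun i hi => ?_⟩
  rw [hz i (Nat.lt_succ_of_le (hn hi))]
  exact mem_of_mem_nhds (ht i)

lemma exists_setOf_forall_lt_eq_subset_of_mem_uniformity {U : Set ((ℕ → Bool) × (ℕ → Bool))}
    (hU : U ∈ uniformity (ℕ → Bool)) :
    ∃ n, {p : (ℕ → Bool) × (ℕ → Bool) | ∀ i < n, p.1 i = p.2 i} ⊆ U := by
  rw [Pi.uniformity, Filter.mem_iInf] at hU
  obtain ⟨J, hJ, t, ht, rfl⟩ := hU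
  obtain ⟨n, hn⟩ := hJ.bddAbove
  refine ⟨n + 1, fun p hp => mem_iInter.2 fun i => ?_⟩
  obtain ⟨s, hs, hst⟩ := ht i
  refine hst ?_
  change (p.1 i, p.2 i) ∈ s
  rw [hp i (Nat.lt_succ_of_le (hn i.2))]
  exact refl_mem_uniformity hs

lemma setOf_forall_lt_eq_mem_uniformity (n : ℕ) :
    {p : (ℕ → Bool) × (ℕ → Bool) | ∀ i < n, p.1 i = p.2 i} ∈ uniformity (ℕ → Bool) := by
  have : {p : (ℕ → Bool) × (ℕ → Bool) | ∀ i < n, p.1 i = p.2 i} =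
      ⋂ i ∈ Finset.range n, {p | p.1 i = p.2 i} := by
    ext z
    simp
  rw [this, Filter.biInter_finset_mem]
  intro i _
  exact Pi.uniformContinuous_proj (fun _ : ℕ => Bool) i
    (show {p : Bool × Bool | p.1 = p.2} ∈ uniformity Bool from mem_principal_self _)

section Embedded

variable {X : Type*} {κ : X → ℕ → Bool} {f : X → X}

lemma isDyadicTower_of_isEmbedding [TopologicalSpace X] (hκ : IsEmbedding κ)
    (hf : Function.Semiconj κ f dyadicOdometer) :
    IsDyadicTower f fun n x => residue n (κ x) where
  map_apply n x := by rw [hf x, residue_dyadicOdometer]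
  isOpen_fiber n c := by
    refine IsOpen.preimage (t := residue n ⁻¹' {c}) hκ.continuous (isOpen_iff_mem_nhds.2 ?_)
    rintro y rfl
    exact mem_of_superset ((isOpen_setOf_forall_lt_eq y n).mem_nhds fun _ _ => rfl)
      fun z hz => (residue_eq_iff n z y).2 hz
  exists_fiber_subset x V hV := by
    rw [hκ.nhds_eq_comap] at hV
    obtain ⟨W, hW, hWV⟩ := hV
    obtain ⟨n, hn⟩ := exists_setOf_forall_lt_eq_subset hW
    exact ⟨n, fun z hz => hWV (hn ((residue_eq_iff n _ _).1 hz))⟩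
  eq_of_le hmn h := by
    rw [residue_eq_iff] at h ⊢
    exact fun i hi => h i (hi.trans_le hmn)

/-- Agreement of the first `n` digits is equality of residues modulo `2 ^ n`, which a rotation
preserves. -/
lemma isEquicontinuousVia_of_semiconj (hf : Function.Semiconj κ f dyadicOdometer) :
    IsEquicontinuousVia κ f := by
  let : UniformSpace X := UniformSpace.comap κ inferInstance
  intro U hU
  obtain ⟨U', hU', hsub⟩ := hU
  obtain ⟨n, hn⟩ := exists_setOf_forall_lt_eq_subset_of_mem_uniformity hU'
  have hiter : ∀ k x, residue n (κ (f^[k] x)) = residue n (κ x) + k := by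
    intro k x
    induction k with
    | zero => simp
    | succ k ih =>
      rw [Function.iterate_succ_apply', hf, residue_dyadicOdometer, ih, Nat.cast_succ, add_assoc]
  refine ⟨_, setOf_forall_lt_eq_mem_uniformity n, fun p hp k => hsub (hn ?_)⟩
  have hp : residue n (κ p.1) = residue n (κ p.2) := (residue_eq_iff n _ _).2 hp
  refine (residue_eq_iff n _ _).1 ?_
  change residue n (κ (f^[k] p.1)) = residue n (κ (f^[k] p.2))
  rw [hiter, hiter, hp]

end Embedded

/-- The Bernoulli measure with equal weights. -/
noncomputable def bernoulliMeasure : Measure (ℕ → Bool) :=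
  Measure.infinitePi fun _ => (PMF.uniformOfFintype Bool).toMeasure

instance : IsProbabilityMeasure bernoulliMeasure := by
  unfold bernoulliMeasure
  infer_instance

lemma bernoulliMeasure_setOf_forall_lt_eq (y : ℕ → Bool) (n : ℕ) :
    bernoulliMeasure {z | ∀ i < n, z i = y i} = (2 ^ n)⁻¹ := by
  have : {z : ℕ → Bool | ∀ i < n, z i = y i} =
      Set.pi (Finset.range n : Set ℕ) fun i => {y i} := by
    ext z
    simp [Set.mem_pi]
  rw [this, bernoulliMeasure, Measure.infinitePi_pi _ fun i _ => measurableSet_singleton _]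
  simp [ENNReal.inv_pow]

/-- The odometer orbit of the zero sequence runs through all residues. -/
lemma exists_residue_eq (n : ℕ) (c : ZMod (2 ^ n)) : ∃ y, residue n y = c := by
  have h := isDyadicTower_of_isEmbedding (κ := (id : (ℕ → Bool) → ℕ → Bool)) IsEmbedding.id
    (f := dyadicOdometer) fun _ => rfl
  refine ⟨dyadicOdometer^[(c - residue n fun _ => false).val] fun _ => false, ?_⟩
  have := h.iterate_apply n (c - residue n fun _ => false).val fun _ => false
  simp only [id] at this
  rw [this, ZMod.natCast_zmod_val]
  ring

lemma bernoulliMeasure_residue (n : ℕ) (c : ZMod (2 ^ n)) :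
    bernoulliMeasure (residue n ⁻¹' {c}) = (2 ^ n)⁻¹ := by
  obtain ⟨y, rfl⟩ := exists_residue_eq n c
  rw [← bernoulliMeasure_setOf_forall_lt_eq y n]
  congr 1
  ext z
  exact residue_eq_iff n z y

lemma bernoulliMeasure_of_countable {s : Set (ℕ → Bool)} (hs : s.Countable) :
    bernoulliMeasure s = 0 := by
  have : NullSingletonClass bernoulliMeasure := by
    refine ⟨fun y => ?_⟩
    have hlim : Tendsto (fun n : ℕ => ((2 : ENNReal) ^ n)⁻¹) atTop (𝓝 0) := by
      simp [ENNReal.inv_pow]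
    refine le_antisymm (ge_of_tendsto' hlim fun n => ?_) zero_le
    rw [← bernoulliMeasure_setOf_forall_lt_eq y n]
    exact measure_mono (singleton_subset_iff.2 fun _ _ => rfl)
  exact hs.measure_zero _

/-- The range is co-countable, hence measurable and of full Bernoulli measure, so the pulled back
measure is a probability measure with the right mass on every fiber. -/
lemma exists_invariant_of_countable_compl_range {X : Type*} [TopologicalSpace X]
    [MeasurableSpace X] [BorelSpace X] {κ : X → ℕ → Bool} {f : X → X} (hκ : IsEmbedding κ)
    (hf : Function.Semiconj κ f dyadicOdometer) (hc : (range κ)ᶜ.Countable) :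
    ∃ μ : Measure X, IsProbabilityMeasure μ ∧ MeasurePreserving f μ μ := by
  have hme : MeasurableEmbedding κ := hκ.measurableEmbedding hc.measurableSet.of_compl
  have hnull := bernoulliMeasure_of_countable hc
  have hpre : ∀ s, bernoulliMeasure.comap κ (κ ⁻¹' s) = bernoulliMeasure s := by
    intro s
    rw [hme.comap_apply, image_preimage_eq_inter_range]
    exact measure_inter_conull hnull
  have : IsProbabilityMeasure (bernoulliMeasure.comap κ) :=
    ⟨by rw [← preimage_univ (f := κ), hpre, measure_univ]⟩
  exact ⟨_, this, (isDyadicTower_of_isEmbedding hκ hf).measurePreserving_of_forall fun n c =>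
    (hpre (residue n ⁻¹' {c})).trans (bernoulliMeasure_residue n c)⟩

end CMI

namespace IsCMI

open CMI

/-! ### Branches and cylinders of a countable Markov interval map -/

variable {I : ℕ+ → Set ℝ} {T : ℝ → ℝ}

lemma convex (hT : IsCMI I T) (n : ℕ+) : Convex ℝ (I n) := (hT.interval n).convex

lemma convex_interior (hT : IsCMI I T) (n : ℕ+) : Convex ℝ (interior (I n)) :=
  (hT.convex n).interior

lemma ordConnected_interior (hT : IsCMI I T) (n : ℕ+) : (interior (I n)).OrdConnected :=
  (hT.convex_interior n).ordConnected

lemma interior_subset_Ioo (hT : IsCMI I T) (n : ℕ+) : interior (I n) ⊆ Ioo 0 1 := by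
  rw [← interior_Icc]
  exact interior_mono (hT.subset_unit n)

lemma differentiableAt (hT : IsCMI I T) {n : ℕ+} {x : ℝ} (hx : x ∈ interior (I n)) :
    DifferentiableAt ℝ T x :=
  (hT.differentiable n).differentiableAt (isOpen_interior.mem_nhds hx)

lemma continuousOn_interior (hT : IsCMI I T) (n : ℕ+) : ContinuousOn T (interior (I n)) :=
  (hT.differentiable n).continuousOn

lemma continuousAt_deriv (hT : IsCMI I T) {n : ℕ+} {x : ℝ} (hx : x ∈ interior (I n)) :
    ContinuousAt (deriv T) x := by
  obtain ⟨α, hα, hol⟩ := hT.holder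
  obtain ⟨C, U, hU, hC⟩ := hol n x hx
  exact (hC.continuousOn hα).continuousAt hU

lemma deriv_ne_zero (hT : IsCMI I T) {n : ℕ+} {x : ℝ} (hx : x ∈ interior (I n)) :
    deriv T x ≠ 0 := by
  have := hT.expanding n x hx
  intro h
  rw [h, abs_zero] at this
  linarith

lemma map_nhds_eq (hT : IsCMI I T) {n : ℕ+} {x : ℝ} (hx : x ∈ interior (I n)) :
    map T (𝓝 x) = 𝓝 (T x) := by
  have hd : ∀ᶠ y in 𝓝 x, HasDerivAt T (deriv T y) y := by
    filter_upwards [isOpen_interior.mem_nhds hx] with y hy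
    exact (hT.differentiableAt hy).hasDerivAt
  exact (hasStrictDerivAt_of_hasDerivAt_of_continuousAt hd
    (hT.continuousAt_deriv hx)).map_nhds_eq (hT.deriv_ne_zero hx)

/-- Darboux: a derivative without zeros on an interval has constant sign. -/
lemma strictMonoOn_or_strictAntiOn (hT : IsCMI I T) (n : ℕ+) :
    StrictMonoOn T (interior (I n)) ∨ StrictAntiOn T (interior (I n)) := by
  rcases hasDerivWithinAt_forall_lt_or_forall_gt_of_forall_ne (hT.convex_interior n)
    (fun x hx => (hT.differentiableAt hx).hasDerivAt.hasDerivWithinAt)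
    (fun x hx => hT.deriv_ne_zero hx) with h | h
  · exact Or.inr (strictAntiOn_of_deriv_neg (hT.convex_interior n) (hT.continuousOn_interior n)
      (by rwa [interior_interior]))
  · exact Or.inl (strictMonoOn_of_deriv_pos (hT.convex_interior n) (hT.continuousOn_interior n)
      (by rwa [interior_interior]))

lemma finite_sdiff_interior (hT : IsCMI I T) (n : ℕ+) : (I n \ interior (I n)).Finite := by
  have hbb : BddBelow (I n) := bddBelow_Icc.mono (hT.subset_unit n)
  have hba : BddAbove (I n) := bddAbove_Icc.mono (hT.subset_unit n)
  refine (toFinite {sInf (I n), sSup (I n)}).subset ?_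
  rintro x ⟨hx, hxi⟩
  by_contra hne
  simp only [mem_insert_iff, mem_singleton_iff, not_or] at hne
  obtain ⟨y, hy, hyx⟩ := exists_lt_of_csInf_lt ⟨x, hx⟩ ((csInf_le hbb hx).lt_of_ne' hne.1)
  obtain ⟨z, hz, hxz⟩ := exists_lt_of_lt_csSup ⟨x, hx⟩ ((le_csSup hba hx).lt_of_ne hne.2)
  exact hxi (mem_interior.2 ⟨Ioo y z, Ioo_subset_Icc_self.trans ((hT.interval n).out hy hz),
    isOpen_Ioo, hyx, hxz⟩)

/-- `T` is open on the interior, so the image stays off 0 and 1. Conversely, removing at most two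
points from the branch costs finitely many values, so the image, an interval, has points of `(0, 1)`
on both sides of any `t`. No continuity at the ends of the branch is needed. -/
lemma image_interior (hT : IsCMI I T) (n : ℕ+) : T '' interior (I n) = Ioo 0 1 := by
  refine Subset.antisymm ?_ ?_
  · rintro _ ⟨x, hx, rfl⟩
    have hnhds : Icc (0 : ℝ) 1 ∈ 𝓝 (T x) := by
      rw [← hT.map_nhds_eq hx]
      exact mem_map.2 <| mem_of_superset (isOpen_interior.mem_nhds hx)
        fun y hy => hT.mapsTo n (interior_subset hy)
    rw [← interior_Icc]
    exact mem_interior_iff_mem_nhds.2 hnhds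
  · have hfin : (T '' (I n \ interior (I n))).Finite := (hT.finite_sdiff_interior n).image T
    have key : ∀ a b : ℝ, 0 ≤ a → b ≤ 1 → a < b →
        ∃ y ∈ Ioo a b, y ∈ T '' interior (I n) := by
      intro a b ha hb hab
      obtain ⟨y, hy, hyn⟩ := ((Ioo_infinite hab).sdiff hfin).nonempty
      obtain ⟨x, hx, rfl⟩ := hT.full n (Ioo_subset_Ioo ha hb hy)
      refine ⟨_, hy, x, ?_, rfl⟩
      by_contra hxi
      exact hyn ⟨x, ⟨hx, hxi⟩, rfl⟩
    intro t ht
    obtain ⟨y, hy, hyT⟩ := key 0 t le_rfl ht.2.le ht.1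
    obtain ⟨z, hz, hzT⟩ := key t 1 ht.1.le le_rfl ht.2
    have hpre : IsPreconnected (T '' interior (I n)) :=
      (hT.convex_interior n).isPreconnected.image T (hT.continuousOn_interior n)
    exact hpre.ordConnected.out hyT hzT ⟨hy.2.le, hz.1.le⟩

lemma nonempty_interior (hT : IsCMI I T) (n : ℕ+) : (interior (I n)).Nonempty := by
  have : (T '' interior (I n)).Nonempty := by
    rw [hT.image_interior n]
    exact nonempty_Ioo.2 one_pos
  exact this.of_image

lemma eq_of_mem_interior (hT : IsCMI I T) {m n : ℕ+} {x : ℝ} (hm : x ∈ interior (I m))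
    (hn : x ∈ interior (I n)) : m = n := by
  by_contra h
  exact disjoint_left.1 (hT.disjoint_interior h) hm hn

end IsCMI

namespace CMI

variable {I : ℕ+ → Set ℝ} {T : ℝ → ℝ}

/-- Deletion of the first `n` entries. -/
def shift (n : ℕ) (w : ℕ → ℕ+) : ℕ → ℕ+ := fun k => w (k + n)

lemma mem_cylinder_succ {w : ℕ → ℕ+} {n : ℕ} {x : ℝ} :
    x ∈ cylinder I T w (n + 1) ↔
      x ∈ interior (I (w 0)) ∧ T x ∈ cylinder I T (shift 1 w) n := by
  constructor
  · exact fun h => ⟨h 0 n.succ_pos, fun k hk => h (k + 1) (Nat.succ_lt_succ hk)⟩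
  · rintro ⟨h₀, h⟩ (_ | k) hk
    · exact h₀
    · exact h k (Nat.succ_lt_succ_iff.1 hk)

lemma cylinder_succ (w : ℕ → ℕ+) (n : ℕ) :
    cylinder I T w (n + 1) = interior (I (w 0)) ∩ T ⁻¹' cylinder I T (shift 1 w) n :=
  Set.ext fun _ => mem_cylinder_succ

lemma cylinder_antitone (w : ℕ → ℕ+) : Antitone (cylinder I T w) :=
  fun _ _ hmn _ hx k hk => hx k (hk.trans_le hmn)

end CMI

namespace IsCMI

open CMI

variable {I : ℕ+ → Set ℝ} {T : ℝ → ℝ}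

lemma isOpen_cylinder (hT : IsCMI I T) (w : ℕ → ℕ+) (n : ℕ) : IsOpen (cylinder I T w n) := by
  induction n generalizing w with
  | zero => simp [CMI.cylinder]
  | succ n ih =>
    rw [cylinder_succ]
    exact (hT.continuousOn_interior _).isOpen_inter_preimage isOpen_interior (ih _)

lemma ordConnected_cylinder (hT : IsCMI I T) (w : ℕ → ℕ+) (n : ℕ) :
    (cylinder I T w n).OrdConnected := by
  induction n generalizing w with
  | zero => simp [CMI.cylinder, ordConnected_univ]
  | succ n ih =>
    rw [cylinder_succ]
    refine ⟨?_⟩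
    rintro a ⟨ha, haT⟩ b ⟨hb, hbT⟩ x hx
    have hxJ := (hT.ordConnected_interior (w 0)).out ha hb hx
    refine ⟨hxJ, ?_⟩
    rcases hT.strictMonoOn_or_strictAntiOn (w 0) with h | h
    · exact (ih _).out haT hbT ⟨h.monotoneOn ha hxJ hx.1, h.monotoneOn hxJ hb hx.2⟩
    · exact (ih _).out hbT haT ⟨h.antitoneOn hxJ hb hx.2, h.antitoneOn ha hxJ hx.1⟩

lemma cylinder_succ_subset_Ioo (hT : IsCMI I T) (w : ℕ → ℕ+) (n : ℕ) :
    cylinder I T w (n + 1) ⊆ Ioo 0 1 := fun _ hx =>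
  hT.interior_subset_Ioo _ (hx 0 n.succ_pos)

/-- The cylinder of length 0 is the whole line; the induction needs a point of `(0, 1)` to lift it
to a branch. -/
lemma nonempty_cylinder_inter_Ioo (hT : IsCMI I T) (w : ℕ → ℕ+) (n : ℕ) :
    (cylinder I T w n ∩ Ioo 0 1).Nonempty := by
  induction n generalizing w with
  | zero => exact ⟨1 / 2, by simp [CMI.cylinder], by norm_num⟩
  | succ n ih =>
    obtain ⟨y, hy, hy'⟩ := ih (shift 1 w)
    rw [← hT.image_interior (w 0)] at hy'
    obtain ⟨x, hx, rfl⟩ := hy'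
    exact ⟨x, mem_cylinder_succ.2 ⟨hx, hy⟩, hT.interior_subset_Ioo _ hx⟩

lemma nonempty_cylinder (hT : IsCMI I T) (w : ℕ → ℕ+) (n : ℕ) : (cylinder I T w n).Nonempty :=
  (hT.nonempty_cylinder_inter_Ioo w n).mono inter_subset_left

lemma forall_eq_of_mem_cylinder (hT : IsCMI I T) {w v : ℕ → ℕ+} {n : ℕ} {x : ℝ}
    (hw : x ∈ cylinder I T w n) (hv : x ∈ cylinder I T v n) : ∀ k < n, w k = v k :=
  fun k hk => hT.eq_of_mem_interior (hw k hk) (hv k hk)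

/-! ### Cylinders shrink -/

lemma exists_deriv_mul_eq (hT : IsCMI I T) {n : ℕ+} {a b : ℝ} (ha : a ∈ interior (I n))
    (hb : b ∈ interior (I n)) (hab : a < b) :
    ∃ ξ ∈ Ioo a b, ξ ∈ interior (I n) ∧ |T b - T a| = |deriv T ξ| * (b - a) := by
  have hsub : Icc a b ⊆ interior (I n) := (hT.ordConnected_interior n).out ha hb
  obtain ⟨ξ, hξ, h⟩ := exists_deriv_eq_slope T hab ((hT.continuousOn_interior n).mono hsub)
    ((hT.differentiable n).mono (Ioo_subset_Icc_self.trans hsub))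
  refine ⟨ξ, hξ, hsub (Ioo_subset_Icc_self hξ), ?_⟩
  have hpos : 0 < b - a := sub_pos.2 hab
  rw [h, abs_div, abs_of_pos hpos, div_mul_cancel₀ _ (ne_of_gt hpos)]

/-- Along a branch, an interval of length at least `δ` is stretched by a definite amount. -/
lemma exists_add_le_abs_sub (hT : IsCMI I T) {δ : ℝ} (hδ : 0 < δ) :
    ∃ η > 0, ∀ n, ∀ a ∈ interior (I n), ∀ b ∈ interior (I n), δ ≤ |a - b| →
      |a - b| + η ≤ |T a - T b| := by
  set U : Set ℝ := ⋃ n, interior (I n) with hU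
  have hUo : IsOpen U := isOpen_iUnion fun _ => isOpen_interior
  have hUI : U ⊆ Icc 0 1 := iUnion_subset fun n =>
    (hT.interior_subset_Ioo n).trans Ioo_subset_Icc_self
  have hUc : Uᶜ.Nonempty := ⟨2, fun h => by have := (hUI h).2; norm_num at this⟩
  -- Expansion need not be uniform near the ends of branches. On the compact set `K`, away from
  -- them, `|T'|` has a lower bound `l > 1`. The middle part of an interval of length at least `δ`
  -- in a branch lies in `K`, has length at least `δ / 2` and is stretched by `l`; the outer pieces,
  -- of length `δ / 4`, do not shrink.
  set K : Set ℝ := {x | δ / 4 ≤ Metric.infDist x Uᶜ} with hK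
  have hKU : K ⊆ U := by
    intro x hx
    by_contra hxU
    have hx : δ / 4 ≤ Metric.infDist x Uᶜ := hx
    rw [Metric.infDist_zero_of_mem hxU] at hx
    linarith
  have hKc : IsCompact K := isCompact_Icc.of_isClosed_subset
    (isClosed_le continuous_const (Metric.continuous_infDist_pt _)) (hKU.trans hUI)
  have hcont : ContinuousOn (fun x => |deriv T x|) K := fun x hx => by
    obtain ⟨n, hn⟩ := mem_iUnion.1 (hKU hx)
    exact (hT.continuousAt_deriv hn).abs.continuousWithinAt
  obtain ⟨l, hl, hlK⟩ : ∃ l > 1, ∀ x ∈ K, l ≤ |deriv T x| := by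
    rcases K.eq_empty_or_nonempty with h | h
    · exact ⟨2, one_lt_two, by simp [h]⟩
    · obtain ⟨x, hx, hmin⟩ := hKc.exists_isMinOn h hcont
      obtain ⟨n, hn⟩ := mem_iUnion.1 (hKU hx)
      exact ⟨_, hT.expanding n x hn, fun y hy => hmin hy⟩
  refine ⟨(l - 1) * (δ / 2), mul_pos (by linarith) (by linarith), ?_⟩
  have key : ∀ n, ∀ a ∈ interior (I n), ∀ b ∈ interior (I n), δ ≤ b - a →
      b - a + (l - 1) * (δ / 2) ≤ |T b - T a| := by
    intro n a ha b hb hab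
    have hsub : Icc a b ⊆ interior (I n) := (hT.ordConnected_interior n).out ha hb
    have hc : a + δ / 4 ∈ interior (I n) := hsub ⟨by linarith, by linarith⟩
    have hd : b - δ / 4 ∈ interior (I n) := hsub ⟨by linarith, by linarith⟩
    obtain ⟨x, -, hxi, hx⟩ := hT.exists_deriv_mul_eq ha hc (by linarith)
    obtain ⟨y, hy, -, hyT⟩ := hT.exists_deriv_mul_eq hc hd (by linarith)
    obtain ⟨z, -, hzi, hz⟩ := hT.exists_deriv_mul_eq hd hb (by linarith)
    have hyK : y ∈ K := by
      refine (Metric.le_infDist hUc).2 fun u hu => ?_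
      by_contra hlt
      rw [not_le, Real.dist_eq, abs_lt] at hlt
      exact hu (mem_iUnion.2 ⟨n, hsub ⟨by linarith [hy.1], by linarith [hy.2]⟩⟩)
    have h₁ : δ / 4 ≤ |T (a + δ / 4) - T a| := by
      rw [hx, add_sub_cancel_left]
      exact le_mul_of_one_le_left (by linarith) (hT.expanding n x hxi).le
    have h₂ : l * (b - a - δ / 2) ≤ |T (b - δ / 4) - T (a + δ / 4)| := by
      rw [hyT, show b - δ / 4 - (a + δ / 4) = b - a - δ / 2 by ring]
      exact mul_le_mul_of_nonneg_right (hlK y hyK) (by linarith)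
    have h₃ : δ / 4 ≤ |T b - T (b - δ / 4)| := by
      rw [hz, sub_sub_cancel]
      exact le_mul_of_one_le_left (by linarith) (hT.expanding n z hzi).le
    have h₄ : (l - 1) * (δ / 2) ≤ (l - 1) * (b - a - δ / 2) :=
      mul_le_mul_of_nonneg_left (by linarith) (by linarith)
    have hsum : |T b - T a| = |T (a + δ / 4) - T a| + |T (b - δ / 4) - T (a + δ / 4)| +
        |T b - T (b - δ / 4)| := by
      rcases hT.strictMonoOn_or_strictAntiOn n with h | h
      · have i₁ := h ha hc (by linarith)
        have i₂ := h hc hd (by linarith)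
        have i₃ := h hd hb (by linarith)
        rw [abs_of_pos (by linarith), abs_of_pos (by linarith), abs_of_pos (by linarith),
          abs_of_pos (by linarith)]
        ring
      · have i₁ := h ha hc (by linarith)
        have i₂ := h hc hd (by linarith)
        have i₃ := h hd hb (by linarith)
        rw [abs_of_neg (by linarith), abs_of_neg (by linarith), abs_of_neg (by linarith),
          abs_of_neg (by linarith)]
        ring
    rw [hsum]
    linarith
  intro n a ha b hb hab
  rcases le_total a b with h | h
  · rw [abs_sub_comm a b, abs_of_nonneg (sub_nonneg.2 h)] at hab ⊢
    rw [abs_sub_comm (T a)]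
    exact key n a ha b hb hab
  · rw [abs_of_nonneg (sub_nonneg.2 h)] at hab ⊢
    exact key n b hb a ha hab

/-- The diameters of the cylinders tend to zero, uniformly. -/
lemma exists_forall_cylinder_abs_sub_lt (hT : IsCMI I T) {ε : ℝ} (hε : 0 < ε) :
    ∃ n, ∀ w, ∀ x ∈ cylinder I T w n, ∀ y ∈ cylinder I T w n, |x - y| < ε := by
  obtain ⟨η, hη, hstep⟩ := hT.exists_add_le_abs_sub hε
  -- Points at distance at least `ε` gain at least `η` at each step in a common branch, so they stay
  -- that far apart; since the images lie in `[0, 1]`, this cannot last longer than about `1 / η`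
  -- steps.
  have key : ∀ n w, ∀ x ∈ cylinder I T w n, ∀ y ∈ cylinder I T w n, ε ≤ |x - y| →
      |x - y| + n * η ≤ |T^[n] x - T^[n] y| := by
    intro n
    induction n with
    | zero => simp
    | succ n ih =>
      intro w x hx y hy hxy
      obtain ⟨hx, hTx⟩ := mem_cylinder_succ.1 hx
      obtain ⟨hy, hTy⟩ := mem_cylinder_succ.1 hy
      have h₁ := hstep _ x hx y hy hxy
      have h₂ := ih _ _ hTx _ hTy (by linarith)
      rw [Function.iterate_succ_apply, Function.iterate_succ_apply]
      push_cast
      linarith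
  obtain ⟨n, hn⟩ := exists_nat_gt (1 / η)
  refine ⟨n + 1, fun w x hx y hy => ?_⟩
  by_contra hxy
  have h := key (n + 1) w x hx y hy (not_lt.1 hxy)
  have hmem : ∀ z ∈ cylinder I T w (n + 1), T^[n + 1] z ∈ Icc (0 : ℝ) 1 := by
    intro z hz
    rw [Function.iterate_succ_apply']
    exact hT.mapsTo _ (interior_subset (hz n n.lt_succ_self))
  have h' : |T^[n + 1] x - T^[n + 1] y| ≤ 1 := by
    have hx' := hmem x hx
    have hy' := hmem y hy
    exact abs_le.2 ⟨by linarith [hx'.1, hy'.2], by linarith [hx'.2, hy'.1]⟩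
  rw [div_lt_iff₀ hη] at hn
  push_cast at h
  have := not_lt.1 hxy
  linarith

lemma exists_forall_closure_abs_sub_lt (hT : IsCMI I T) {ε : ℝ} (hε : 0 < ε) :
    ∃ n, ∀ w, ∀ x ∈ closure (cylinder I T w n), ∀ y ∈ closure (cylinder I T w n),
      |x - y| < ε := by
  obtain ⟨n, hn⟩ := hT.exists_forall_cylinder_abs_sub_lt (show 0 < ε / 3 by linarith)
  refine ⟨n, fun w x hx y hy => ?_⟩
  obtain ⟨x', hx', hxx'⟩ := Metric.mem_closure_iff.1 hx (ε / 3) (by linarith)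
  obtain ⟨y', hy', hyy'⟩ := Metric.mem_closure_iff.1 hy (ε / 3) (by linarith)
  have h := hn w x' hx' y' hy'
  rw [Real.dist_eq] at hxx' hyy'
  rw [abs_lt] at *
  constructor <;> linarith [hxx'.1, hxx'.2, hyy'.1, hyy'.2, h.1, h.2]

end IsCMI

namespace IsCMI

open CMI

variable {I : ℕ+ → Set ℝ} {T : ℝ → ℝ}

/-! ### The coding map -/

lemma coding_mem_closure (hT : IsCMI I T) (w : ℕ → ℕ+) (n : ℕ) :
    coding I T w ∈ closure (cylinder I T w n) := by
  -- Lengths start at 1 because the cylinder of length 0 is not bounded.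
  have hne : (⋂ n, closure (cylinder I T w (n + 1))).Nonempty := by
    refine IsCompact.nonempty_iInter_of_sequence_nonempty_isCompact_isClosed _
      (fun n => closure_mono (cylinder_antitone w (Nat.le_succ _)))
      (fun n => (hT.nonempty_cylinder w _).closure) ?_ fun n => isClosed_closure
    exact isCompact_Icc.of_isClosed_subset isClosed_closure (closure_minimal
      ((hT.cylinder_succ_subset_Ioo w 0).trans Ioo_subset_Icc_self) isClosed_Icc)
  obtain ⟨x, hx⟩ := hne
  have hx' : ∀ n, x ∈ closure (cylinder I T w n) := fun n =>
    closure_mono (cylinder_antitone w n.le_succ) (mem_iInter.1 hx n)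
  exact Classical.epsilon_spec (p := fun x => ∀ n, x ∈ closure (cylinder I T w n)) ⟨x, hx'⟩ n

lemma coding_eq_of_mem_closure (hT : IsCMI I T) {w : ℕ → ℕ+} {x : ℝ}
    (hx : ∀ n, x ∈ closure (cylinder I T w (n + 1))) : coding I T w = x := by
  refine eq_of_abs_sub_le_all fun ε hε => ?_
  obtain ⟨n, hn⟩ := hT.exists_forall_closure_abs_sub_lt hε
  exact (hn w _ (hT.coding_mem_closure w n) _
    (closure_mono (cylinder_antitone w n.le_succ) (hx n))).le

lemma coding_eq_of_mem_cylinder (hT : IsCMI I T) {w : ℕ → ℕ+} {x : ℝ}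
    (hx : ∀ n, x ∈ cylinder I T w n) : coding I T w = x :=
  hT.coding_eq_of_mem_closure fun _ => subset_closure (hx _)

lemma coding_mem_Icc (hT : IsCMI I T) (w : ℕ → ℕ+) : coding I T w ∈ Icc (0 : ℝ) 1 :=
  closure_minimal ((hT.cylinder_succ_subset_Ioo w 0).trans Ioo_subset_Icc_self) isClosed_Icc
    (hT.coding_mem_closure w 1)

/-- A point inside all cylinders of `v` has no other code. -/
lemma eq_of_coding_mem_cylinder (hT : IsCMI I T) {w v : ℕ → ℕ+}
    (h : ∀ n, coding I T w ∈ cylinder I T v n) : w = v := by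
  funext k
  obtain ⟨y, hyv, hyw⟩ := mem_closure_iff.1 (hT.coding_mem_closure w (k + 1)) _
    (hT.isOpen_cylinder v (k + 1)) (h (k + 1))
  exact hT.forall_eq_of_mem_cylinder hyw hyv k k.lt_succ_self

lemma invFun_coding_eq (hT : IsCMI I T) {w : ℕ → ℕ+} {x : ℝ} (hx : ∀ n, x ∈ cylinder I T w n) :
    Function.invFun (coding I T) x = w := by
  have h : coding I T (Function.invFun (coding I T) x) = x :=
    Function.invFun_eq ⟨w, hT.coding_eq_of_mem_cylinder hx⟩
  exact hT.eq_of_coding_mem_cylinder (by rwa [h])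

lemma mem_phaseSpace_iff (hT : IsCMI I T) {x : ℝ} :
    x ∈ phaseSpace I T ↔ ∃ w, ∀ n, x ∈ cylinder I T w n := by
  constructor
  · rintro ⟨hx, hb⟩
    have hk : ∀ k, ∃ m, T^[k] x ∈ interior (I m) := by
      intro k
      obtain ⟨m, hm⟩ := mem_iUnion.1 (hx k)
      refine ⟨m, ?_⟩
      rw [← self_sdiff_frontier]
      exact ⟨hm, fun hf => hb ⟨k, fun j _ => hx j, Or.inr (mem_iUnion.2 ⟨m, hf⟩)⟩⟩
    choose w hw using hk
    exact ⟨w, fun n k _ => hw k⟩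
  · rintro ⟨w, hw⟩
    have hk : ∀ k, T^[k] x ∈ interior (I (w k)) := fun k => hw (k + 1) k k.lt_succ_self
    refine ⟨fun k => mem_iUnion.2 ⟨_, interior_subset (hk k)⟩, ?_⟩
    rintro ⟨k, -, hb⟩
    rcases hb with hb | hb
    · have := hT.interior_subset_Ioo _ (hk k)
      rcases hb with hb | hb
      · rw [hb] at this
        exact lt_irrefl _ this.1
      · rw [mem_singleton_iff.1 hb] at this
        exact lt_irrefl _ this.2
    · obtain ⟨m, hm⟩ := mem_iUnion.1 hb
      -- An interior point of one branch is no endpoint of another: the interior of a branch is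
      -- dense in its closure, so the two interiors would meet.
      have hcl : T^[k] x ∈ closure (interior (I m)) := by
        rw [(hT.convex m).closure_interior_eq_closure_of_nonempty_interior
          (hT.nonempty_interior m)]
        exact frontier_subset_closure hm
      obtain ⟨y, hy, hym⟩ := mem_closure_iff.1 hcl _ isOpen_interior (hk k)
      obtain rfl := hT.eq_of_mem_interior hy hym
      exact hm.2 (hk k)

/-- A point of the phase space lies in all the cylinders of its code. -/
lemma mem_cylinder_invFun (hT : IsCMI I T) {x : ℝ} (hx : x ∈ phaseSpace I T) (n : ℕ) :
    x ∈ cylinder I T (Function.invFun (coding I T) x) n := by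
  obtain ⟨w, hw⟩ := hT.mem_phaseSpace_iff.1 hx
  rw [hT.invFun_coding_eq hw]
  exact hw n

lemma coding_invFun (hT : IsCMI I T) {x : ℝ} (hx : x ∈ phaseSpace I T) :
    coding I T (Function.invFun (coding I T) x) = x :=
  hT.coding_eq_of_mem_cylinder (hT.mem_cylinder_invFun hx)

lemma invFun_coding (hT : IsCMI I T) {w : ℕ → ℕ+} (hw : coding I T w ∈ phaseSpace I T) :
    Function.invFun (coding I T) (coding I T w) = w :=
  (hT.eq_of_coding_mem_cylinder (hT.mem_cylinder_invFun hw)).symm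

/-- If the shifted code does not represent an endpoint of `[0, 1]`, then the coding map intertwines
the shift and `T`. -/
lemma coding_of_coding_shift_mem_Ioo (hT : IsCMI I T) {w : ℕ → ℕ+}
    (h : coding I T (shift 1 w) ∈ Ioo (0 : ℝ) 1) :
    coding I T w ∈ interior (I (w 0)) ∧ T (coding I T w) = coding I T (shift 1 w) := by
  obtain ⟨z, hz, hTz⟩ : coding I T (shift 1 w) ∈ T '' interior (I (w 0)) := by
    rwa [hT.image_interior]
  have hcode : coding I T w = z := by
    refine hT.coding_eq_of_mem_closure fun n => mem_closure_iff_nhds.2 fun V hV => ?_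
    -- `T` maps neighborhoods of `z` onto neighborhoods of the shifted point. These meet all
    -- cylinders of the shifted word, and pulling back along the branch gives points of the
    -- cylinders of `w` near `z`.
    have hmem : T '' (V ∩ interior (I (w 0))) ∈ 𝓝 (coding I T (shift 1 w)) := by
      rw [← hTz, ← hT.map_nhds_eq hz]
      exact image_mem_map (inter_mem hV (isOpen_interior.mem_nhds hz))
    obtain ⟨_, ⟨x, ⟨hxV, hxJ⟩, rfl⟩, hx⟩ :=
      mem_closure_iff_nhds.1 (hT.coding_mem_closure (shift 1 w) n) _ hmem
    exact ⟨x, hxV, mem_cylinder_succ.2 ⟨hxJ, hx⟩⟩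
  rw [hcode]
  exact ⟨hz, hTz⟩

lemma coding_shift_of_succ (hT : IsCMI I T) {w : ℕ → ℕ+} {n : ℕ}
    (h : coding I T (shift (n + 1) w) ∈ Ioo (0 : ℝ) 1) :
    coding I T (shift n w) ∈ interior (I (w n)) ∧
      T (coding I T (shift n w)) = coding I T (shift (n + 1) w) := by
  have hs : shift (n + 1) w = shift 1 (shift n w) := by
    funext k
    simp only [shift]
    congr 1
    omega
  rw [hs] at h ⊢
  simpa [shift] using hT.coding_of_coding_shift_mem_Ioo h

/-- Interiors of branches lie in `(0, 1)`, so a code whose shift reaches an endpoint of `[0, 1]`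
stays at endpoints under all further shifts. -/
lemma coding_shift_mem_Ioo_of_le (hT : IsCMI I T) {w : ℕ → ℕ+} {m n : ℕ} (hmn : m ≤ n)
    (h : coding I T (shift n w) ∈ Ioo (0 : ℝ) 1) : coding I T (shift m w) ∈ Ioo (0 : ℝ) 1 := by
  induction n, hmn using Nat.le_induction with
  | base => exact h
  | succ n _ ih => exact ih (hT.interior_subset_Ioo _ (hT.coding_shift_of_succ h).1)

/-- A code represents a point of the phase space if and only if none of its shifts represents an
endpoint of `[0, 1]`. -/
lemma coding_mem_phaseSpace_iff (hT : IsCMI I T) {w : ℕ → ℕ+} :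
    coding I T w ∈ phaseSpace I T ↔ ∀ n, coding I T (shift n w) ∈ Ioo (0 : ℝ) 1 := by
  constructor
  · intro h n
    have hc : ∀ k, T^[k] (coding I T w) ∈ interior (I (w k)) := by
      intro k
      have := hT.mem_cylinder_invFun h (k + 1) k k.lt_succ_self
      rwa [hT.invFun_coding h] at this
    have heq : coding I T (shift n w) = T^[n] (coding I T w) := by
      refine hT.coding_eq_of_mem_cylinder fun m k _ => ?_
      rw [← Function.iterate_add_apply]
      exact hc (k + n)
    rw [heq]
    exact hT.interior_subset_Ioo _ (hc n)
  · intro h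
    refine hT.mem_phaseSpace_iff.2 ⟨w, fun n k _ => ?_⟩
    have hk : ∀ k, T^[k] (coding I T w) = coding I T (shift k w) := by
      intro k
      induction k with
      | zero => rfl
      | succ k ih =>
        rw [Function.iterate_succ_apply', ih, (hT.coding_shift_of_succ (h (k + 1))).2]
    rw [hk]
    exact (hT.coding_shift_of_succ (h (k + 1))).1

lemma coding_baireOdometer_mem (hT : IsCMI I T) {w : ℕ → ℕ+} (h : coding I T w ∈ phaseSpace I T) :
    coding I T (baireOdometer w) ∈ phaseSpace I T := by
  rw [hT.coding_mem_phaseSpace_iff] at h ⊢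
  intro n
  refine hT.coding_shift_mem_Ioo_of_le (n := n + (w 0 : ℕ)) (Nat.le_add_right _ _) ?_
  -- The odometer rewrites only a finite prefix, so far shifts of the new code are shifts of the old
  -- one.
  have hs : shift (n + (w 0 : ℕ)) (baireOdometer w) = shift (n + 2) w := by
    funext k
    simp only [shift]
    rw [show k + (n + (w 0 : ℕ)) = (w 0 : ℕ) + (k + n) by omega, baireOdometer_of_le, add_assoc]
  rw [hs]
  exact h _

lemma mapsTo_odometer (hT : IsCMI I T) :
    MapsTo (odometer I T) (phaseSpace I T) (phaseSpace I T) := fun x hx =>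
  hT.coding_baireOdometer_mem (by rwa [hT.coding_invFun hx])

lemma invFun_odometer (hT : IsCMI I T) {x : ℝ} (hx : x ∈ phaseSpace I T) :
    Function.invFun (coding I T) (odometer I T x) =
      baireOdometer (Function.invFun (coding I T) x) :=
  hT.invFun_coding (hT.mapsTo_odometer hx)

/-! ### Countably many codes are exceptional -/

/-- Cylinders of equal length that both accumulate at 0 are intervals in `(0, 1)`, hence meet, hence
carry the same word. -/
lemma subsingleton_coding_eq_zero (hT : IsCMI I T) : {w | coding I T w = 0}.Subsingleton := by
  intro w hw v hv
  have hw : coding I T w = 0 := hw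
  have hv : coding I T v = 0 := hv
  funext k
  obtain ⟨a, ha⟩ := hT.nonempty_cylinder w (k + 1)
  obtain ⟨b, hb, hba⟩ := mem_closure_iff.1 (hv ▸ hT.coding_mem_closure v (k + 1)) (Iio a) isOpen_Iio
    (hT.cylinder_succ_subset_Ioo w k ha).1 |>.imp fun _ h => h.symm
  obtain ⟨c, hcb, hc⟩ := mem_closure_iff.1 (hw ▸ hT.coding_mem_closure w (k + 1)) (Iio b) isOpen_Iio
    (hT.cylinder_succ_subset_Ioo v k hb).1
  exact hT.forall_eq_of_mem_cylinder
    ((hT.ordConnected_cylinder w (k + 1)).out hc ha ⟨hcb.le, hba.le⟩) hb k k.lt_succ_self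

lemma subsingleton_coding_eq_one (hT : IsCMI I T) : {w | coding I T w = 1}.Subsingleton := by
  intro w hw v hv
  have hw : coding I T w = 1 := hw
  have hv : coding I T v = 1 := hv
  funext k
  obtain ⟨a, ha⟩ := hT.nonempty_cylinder w (k + 1)
  obtain ⟨b, hb, hab⟩ := mem_closure_iff.1 (hv ▸ hT.coding_mem_closure v (k + 1)) (Ioi a) isOpen_Ioi
    (hT.cylinder_succ_subset_Ioo w k ha).2 |>.imp fun _ h => h.symm
  obtain ⟨c, hbc, hc⟩ := mem_closure_iff.1 (hw ▸ hT.coding_mem_closure w (k + 1)) (Ioi b) isOpen_Ioi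
    (hT.cylinder_succ_subset_Ioo v k hb).2
  exact hT.forall_eq_of_mem_cylinder
    ((hT.ordConnected_cylinder w (k + 1)).out ha hc ⟨hab.le, hbc.le⟩) hb k k.lt_succ_self

lemma countable_setOf_coding_notMem (hT : IsCMI I T) :
    {w | coding I T w ∉ phaseSpace I T}.Countable := by
  have hE : {w | coding I T w ∉ Ioo (0 : ℝ) 1}.Countable := by
    refine (hT.subsingleton_coding_eq_zero.finite.union
      hT.subsingleton_coding_eq_one.finite).countable.mono fun w hw => ?_
    have h := hT.coding_mem_Icc w
    by_contra hne
    simp only [mem_union, mem_ofPred_eq, not_or] at hne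
    exact hw ⟨h.1.lt_of_ne' hne.1, h.2.lt_of_ne hne.2⟩
  have hshift : ∀ n, {w | coding I T (shift n w) ∉ Ioo (0 : ℝ) 1}.Countable := by
    intro n
    -- A sequence is determined by its first `n` entries, with countably many choices, and its
    -- `n`-th shift, which lies in the countable set of codes of endpoints.
    let g : (ℕ → ℕ+) → (Fin n → ℕ+) × (ℕ → ℕ+) := fun w => (fun i => w i, shift n w)
    have hg : Function.Injective g := by
      intro w v h
      funext k
      rcases lt_or_ge k n with hk | hk
      · have hfst : (g w).1 = (g v).1 := congrArg Prod.fst h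
        exact congrFun hfst ⟨k, hk⟩
      · have := congrFun (congrArg Prod.snd h) (k - n)
        simpa only [g, shift, Nat.sub_add_cancel hk] using this
    have hc := (countable_univ (α := Fin n → ℕ+)).prod hE
    exact (hc.preimage hg).mono fun w hw => mk_mem_prod (mem_univ _) hw
  refine (countable_iUnion hshift).mono fun w hw => ?_
  have hw : coding I T w ∉ phaseSpace I T := hw
  rw [hT.coding_mem_phaseSpace_iff, not_forall] at hw
  exact mem_iUnion.2 hw

/-! ### The conjugacy to the dyadic odometer -/

lemma isEmbedding_dyadicCode (hT : IsCMI I T) : IsEmbedding (dyadicCode I T) := by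
  have hcont : Continuous (dyadicCode I T) := by
    refine continuous_pi fun i =>
      IsLocallyConstant.continuous ((IsLocallyConstant.iff_eventually_eq _).2 fun x => ?_)
    have hnhds : ∀ᶠ y : phaseSpace I T in 𝓝 x,
        (y : ℝ) ∈ cylinder I T (Function.invFun (coding I T) x) (i + 1) :=
      continuous_subtype_val.continuousAt
        ((hT.isOpen_cylinder _ _).mem_nhds (hT.mem_cylinder_invFun x.2 _))
    filter_upwards [hnhds] with y hy
    exact toDyadic_eq_of_forall_eq fun k hk => hT.forall_eq_of_mem_cylinder
      (hT.mem_cylinder_invFun y.2 (i + 1)) hy k (Nat.lt_succ_of_le hk)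
  have hind : IsInducing (dyadicCode I T) := by
    refine isInducing_iff_nhds.2 fun x => le_antisymm (hcont.tendsto x).le_comap ?_
    intro V hV
    rw [nhds_subtype_eq_comap] at hV
    obtain ⟨W, hW, hWV⟩ := hV
    obtain ⟨ε, hε, hball⟩ := Metric.mem_nhds_iff.1 hW
    obtain ⟨n, hn⟩ := hT.exists_forall_cylinder_abs_sub_lt hε
    -- The digits up to the end of the `n`-th block fix a cylinder of diameter at most `ε`. Their
    -- number depends on `x`.
    refine ⟨_, (isOpen_setOf_forall_lt_eq (dyadicCode I T x)
      (partialSum (Function.invFun (coding I T) x) n)).mem_nhds fun _ _ => rfl, fun y hy => ?_⟩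
    have heq := forall_eq_of_toDyadic_eq fun i hi => (hy i hi).symm
    refine hWV (hball (hn (Function.invFun (coding I T) x) y (fun k hk => ?_) x
      (hT.mem_cylinder_invFun x.2 n)))
    rw [heq k hk]
    exact hT.mem_cylinder_invFun y.2 n k hk
  exact hind.isEmbedding

lemma semiconj_dyadicCode (hT : IsCMI I T) :
    Function.Semiconj (dyadicCode I T) hT.mapsTo_odometer.restrict dyadicOdometer := fun x => by
  change toDyadic (Function.invFun (coding I T) (odometer I T x)) = _
  rw [hT.invFun_odometer x.2, toDyadic_baireOdometer]
  rfl

lemma countable_compl_range_dyadicCode (hT : IsCMI I T) : (range (dyadicCode I T))ᶜ.Countable := by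
  refine (countable_setOf_finite_zeros.union
    (hT.countable_setOf_coding_notMem.image toDyadic)).mono fun y hy => ?_
  by_cases hfin : {i | y i = false}.Finite
  · exact Or.inl hfin
  · obtain ⟨w, rfl⟩ := exists_toDyadic_eq hfin
    refine Or.inr ⟨w, fun hw => hy ⟨⟨_, hw⟩, ?_⟩, rfl⟩
    change toDyadic (Function.invFun (coding I T) (coding I T w)) = _
    rw [hT.invFun_coding hw]

end IsCMI

theorem corollary5p5 (I : ℕ+ → Set ℝ) (T : ℝ → ℝ) (hT : IsCMI I T) :
    ∃ h : MapsTo (CMI.odometer I T) (CMI.phaseSpace I T) (CMI.phaseSpace I T),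
      (IsMinimalMap h.restrict ∧ IsUniquelyErgodic h.restrict) ∧
      HasZeroTopologicalEntropy h.restrict ∧
      (∀ (μ : Measure (CMI.phaseSpace I T)) [IsProbabilityMeasure μ]
        (hμ : MeasurePreserving h.restrict μ μ), HasPurelyDiscreteSpectrum hμ) ∧
      (IsEmbedding (CMI.dyadicCode I T) ∧
        Function.Semiconj (CMI.dyadicCode I T) h.restrict CMI.dyadicOdometer ∧
        IsEquicontinuousVia (CMI.dyadicCode I T) h.restrict) := by
  have htower := CMI.isDyadicTower_of_isEmbedding hT.isEmbedding_dyadicCode hT.semiconj_dyadicCode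
  obtain ⟨μ, hμ, hμT⟩ := CMI.exists_invariant_of_countable_compl_range hT.isEmbedding_dyadicCode
    hT.semiconj_dyadicCode hT.countable_compl_range_dyadicCode
  exact ⟨hT.mapsTo_odometer, ⟨htower.isMinimalMap, htower.isUniquelyErgodic hμT⟩,
    htower.hasZeroTopologicalEntropy hμT, fun ν _ hν => htower.hasPurelyDiscreteSpectrum hν,
    hT.isEmbedding_dyadicCode, hT.semiconj_dyadicCode,
    CMI.isEquicontinuousVia_of_semiconj hT.semiconj_dyadicCode⟩
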